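/- **Setting.** Let $(\Omega,\mathcal G,Q)$ be a probability space with a filtration $(\mathcal F_s)_{s\ge 0}$, and fix a maturity $T\ge 0$ and $\alpha\in[0,1]$. Let $S\ge 0$ (the asset) and $D>0$ (the discount factor) be $\mathcal F$-adapted real processes with right-continuous paths, put $B(t,u)=D_u/D_t$, and suppose that $Q$ is a risk neutral measure: for every $t\le T$, $(B(t,u)S_u)_{t\le u\le T}$ is an $\mathcal F$-martingale under $Q$. Let $\tau:\Omega\to[0,\infty]$ be a random time with $\tau>0$ a.s., $\mathcal H_t=\sigma(\mathbf 1_{\{\tau\le s\}}:s\le t)$ and $\mathcal G_t=\mathcal F_t\vee\mathcal H_t$. The price at time $t\le T$ of the Random Time Forward Starting (RTFS) call is $$c(t,T)=\mathbf E^Q[B(t,T)(S_T-\alpha S_{\tau\wedge T})^+\mid\mathcal G_t].$$ For $s\le u\le T$ let $c(s,u,T)=\mathbf E^Q[B(s,T)(S_T-\alpha S_u)^+\mid\mathcal F_s]$ be the price of the forward start call with deterministic determination time $u$. Versions are chosen so that $(u,\omega)\mapsto c(s,u,T)(\omega)$ is measurable for each $s$ and $u\mapsto c(u,u,T)$ is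 a.s. right-continuous. Let $F_u=Q(\tau\le u\mid\mathcal F_u)$, and assume that a version of $F$ on $[0,T]$ has a.s. continuous paths with $F_u<1$ for all $u\le T$. Let $\Gamma_u=-\ln(1-F_u)$ be the hazard process. Under either hypothesis below its paths are a.s. nondecreasing, and $d\Gamma_u$ denotes the pathwise Lebesgue–Stieltjes measure. Consider the hypotheses * **(H)** every $(\mathcal F_s)$-martingale is a $(\mathcal G_s)$-martingale; * **(IND)** the $\sigma$-algebras $\bigvee_s\mathcal F_s$ and $\bigvee_s\mathcal H_s$ are independent. **Proposition.** Let $0\le t\le T$. (a) Under (H), almost surely, $$\begin{aligned}c(t,T)={}&\mathbf E^Q[B(t,T)(S_T-\alpha S_\tau)^+\mid\mathcal G_t]\,\mathbf 1_{\{0<\tau\le t\}}+(1-\alpha)S_t\mathbf 1_{\{\tau>t\}}\\&+\mathbf 1_{\{\tau>t\}}\mathbf E^Q\Big[\int_t^TB(t,u)\,c(u,u,T)\,e^{-(\Gamma_u-\Gamma_t)}\,d\Gamma_u\,\Big|\,\mathcal F_t\Big]\\&-(1-\alpha)\mathbf 1_{\{\tau>t\}}\mathbf E^Q\Big[\int_t^TB(t,u)\,S_u\,e^{-(\Gamma_u-\Gamma_t)}\,d\Gamma_u\,\Big|\,\mathcal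 F_t\Big].\end{aligned}$$ (b) Under (IND), almost surely, $$c(t,T)=\mathbf E^Q[B(t,T)(S_T-\alpha S_\tau)^+\mid\mathcal G_t]\,\mathbf 1_{\{0<\tau\le t\}}+\mathbf 1_{\{\tau>t\}}\Big[\int_t^Tc(t,u,T)\,e^{-(\Gamma_u-\Gamma_t)}\,d\Gamma_u+(1-\alpha)S_t\,e^{-(\Gamma_T-\Gamma_t)}\Big].$$ In both parts all the random variables under the expectations are integrable, and the pathwise integrals converge absolutely almost surely. -/

import Mathlib

open MeasureTheory ProbabilityTheory Filter Set
open scoped NNReal ENNReal Topology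

noncomputable section

namespace RTFS

variable {Ω : Type*} [m : MeasurableSpace Ω]

/-- The discounting process `B(t,u) = D_u / D_t`, where `D_u = B(0,u)` is the discount factor
from time `0` to time `u`. -/
def discount (D : ℝ≥0 → Ω → ℝ) (t u : ℝ≥0) (ω : Ω) : ℝ := D u ω / D t ω

/-- A market with one asset `S` and discount factor `D`, both adapted to `𝓕` with right-continuous
paths, `D` positive (and possibly random), `S` nonnegative. `Q` is a risk neutral measure up to the
maturity `T`: for every `t ≤ T` the process `(B(t,u) S_u)`, `t ≤ u ≤ T`, is an `𝓕`-martingale. -/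
structure IsMarket (Q : Measure Ω) (𝓕 : Filtration ℝ≥0 m) (D S : ℝ≥0 → Ω → ℝ) (T : ℝ≥0) :
    Prop where
  discount_adapted : StronglyAdapted 𝓕 D
  discount_pos : ∀ u ω, 0 < D u ω
  discount_rightCts : ∀ ω u, ContinuousWithinAt (fun v => D v ω) (Ici u) u
  asset_adapted : StronglyAdapted 𝓕 S
  asset_nonneg : ∀ u ω, 0 ≤ S u ω
  asset_rightCts : ∀ ω u, ContinuousWithinAt (fun v => S v ω) (Ici u) u
  integrable : ∀ t u, t ≤ u → u ≤ T → Integrable (fun ω => discount D t u ω * S u ω) Q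
  martingale : ∀ t u v, t ≤ u → u ≤ v → v ≤ T →
    Q[fun ω => discount D t v ω * S v ω | 𝓕 u] =ᵐ[Q] fun ω => discount D t u ω * S u ω

/-- The process `H_s = 1_{τ ≤ s}`. -/
def occurrence (τ : Ω → ℝ≥0∞) (s : ℝ≥0) : Ω → ℝ := {ω | τ ω ≤ s}.indicator 1

/-- The filtration `𝓗_t = σ(H_s : s ≤ t)`. -/
def occurrenceFiltration (τ : Ω → ℝ≥0∞) (hτ : Measurable τ) : Filtration ℝ≥0 m :=
  Filtration.natural (occurrence τ) fun _ =>
    stronglyMeasurable_one.indicator (measurableSet_le hτ measurable_const)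

/-- The enlarged filtration `𝓖_t = 𝓕_t ∨ 𝓗_t`. -/
def enlarged (𝓕 : Filtration ℝ≥0 m) (τ : Ω → ℝ≥0∞) (hτ : Measurable τ) : Filtration ℝ≥0 m :=
  𝓕 ⊔ occurrenceFiltration τ hτ

/-- Hypothesis (H): every `𝓕`-martingale is a `𝓖`-martingale. -/
def HypothesisH (Q : Measure Ω) (𝓕 : Filtration ℝ≥0 m) (τ : Ω → ℝ≥0∞) (hτ : Measurable τ) : Prop :=
  ∀ M : ℝ≥0 → Ω → ℝ, Martingale M 𝓕 Q → Martingale M (enlarged 𝓕 τ hτ) Q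

/-- Hypothesis (IND): the σ-algebras generated by the filtrations `𝓕` and `𝓗` are independent. -/
def HypothesisIND (Q : Measure Ω) (𝓕 : Filtration ℝ≥0 m) (τ : Ω → ℝ≥0∞) (hτ : Measurable τ) :
    Prop :=
  Indep (⨆ s, 𝓕 s) (⨆ s, occurrenceFiltration τ hτ s) Q

/-- The discounted payoff `B(t,T) (S_T - α S_{τ ∧ T})⁺` of the random time forward starting call. -/
def payoff (D S : ℝ≥0 → Ω → ℝ) (T : ℝ≥0) (α : ℝ) (τ : Ω → ℝ≥0∞) (t : ℝ≥0) (ω : Ω) : ℝ :=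
  discount D t T ω * max (S T ω - α * S (min (τ ω) (T : ℝ≥0∞)).toNNReal ω) 0

/-- The discounted payoff `B(t,T) (S_T - α S_τ)⁺` of the call already struck at `τ`.
It is used only on an event where `τ` is finite. -/
def struckPayoff (D S : ℝ≥0 → Ω → ℝ) (T : ℝ≥0) (α : ℝ) (τ : Ω → ℝ≥0∞) (t : ℝ≥0) (ω : Ω) : ℝ :=
  discount D t T ω * max (S T ω - α * S (τ ω).toNNReal ω) 0

/-- The price `c(t,T) = E^Q[B(t,T) (S_T - α S_{τ ∧ T})⁺ | 𝓖_t]` of the random time forward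
starting call. -/
def price (Q : Measure Ω) (𝓕 : Filtration ℝ≥0 m) (D S : ℝ≥0 → Ω → ℝ) (T : ℝ≥0) (α : ℝ)
    (τ : Ω → ℝ≥0∞) (hτ : Measurable τ) (t : ℝ≥0) : Ω → ℝ :=
  Q[payoff D S T α τ t | enlarged 𝓕 τ hτ t]

/-- The already struck term `E^Q[B(t,T) (S_T - α S_τ)⁺ | 𝓖_t] 1_{0 < τ ≤ t}`. -/
def struckTerm (Q : Measure Ω) (𝓕 : Filtration ℝ≥0 m) (D S : ℝ≥0 → Ω → ℝ) (T : ℝ≥0) (α : ℝ)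
    (τ : Ω → ℝ≥0∞) (hτ : Measurable τ) (t : ℝ≥0) : Ω → ℝ :=
  {ω | 0 < τ ω ∧ τ ω ≤ t}.indicator (Q[struckPayoff D S T α τ t | enlarged 𝓕 τ hτ t])

/-- `c s u` is a version of the forward start price
`c(s,u,T) = E^Q[B(s,T) (S_T - α S_u)⁺ | 𝓕_s]`, for `s ≤ u ≤ T`. As these random variables are only
determined up to null sets and have to be integrated over `u`, the version is measurable in
`(u,ω)` for each `s`, and the process `c(u,u,T)` has almost surely right-continuous paths. -/
structure IsForwardStartPrice (Q : Measure Ω) (𝓕 : Filtration ℝ≥0 m) (D S : ℝ≥0 → Ω → ℝ) (T : ℝ≥0)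
    (α : ℝ) (c : ℝ≥0 → ℝ≥0 → Ω → ℝ) : Prop where
  version : ∀ s u, s ≤ u → u ≤ T →
    c s u =ᵐ[Q] Q[fun ω => discount D s T ω * max (S T ω - α * S u ω) 0 | 𝓕 s]
  measurable : ∀ s, Measurable fun p : ℝ≥0 × Ω => c s p.1 p.2
  rightCts : ∀ᵐ ω ∂Q, ∀ u < T, ContinuousWithinAt (fun v => c v v ω) (Ici u) u

/-- `F` is a version of the conditional distribution process `F_u = Q(τ ≤ u | 𝓕_u)`, `u ≤ T`, whose
paths are almost surely continuous with `F_u < 1`. -/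
structure IsCondDistribution (Q : Measure Ω) (𝓕 : Filtration ℝ≥0 m) (τ : Ω → ℝ≥0∞) (T : ℝ≥0)
    (F : ℝ≥0 → Ω → ℝ) : Prop where
  version : ∀ u ≤ T, F u =ᵐ[Q] Q⟦{ω | τ ω ≤ u} | 𝓕 u⟧
  lt_one : ∀ᵐ ω ∂Q, ∀ u ≤ T, F u ω < 1
  continuous : ∀ᵐ ω ∂Q, ContinuousOn (fun u => F u ω) (Iic T)

/-- The hazard process `Γ = -ln(1 - F)`. -/
def hazard (F : ℝ≥0 → Ω → ℝ) (u : ℝ≥0) (ω : Ω) : ℝ := -Real.log (1 - F u ω)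

open scoped Classical in
/-- The Lebesgue–Stieltjes measure `dg` on `[0,T]` of a nondecreasing right-continuous function `g`
on `[0,T]`. (It is set to `0` for other `g`; the paths of the hazard process are almost surely
nondecreasing when (H) or (IND) holds.) -/
def stieltjes (g : ℝ≥0 → ℝ) (T : ℝ≥0) : Measure ℝ≥0 :=
  if h : Monotone (fun u => g (min u T)) then h.stieltjesFunction.measure else 0

/-- The random measure `dΓ` on `[0,T]`. -/
def hazardMeasure (F : ℝ≥0 → Ω → ℝ) (T : ℝ≥0) (ω : Ω) : Measure ℝ≥0 :=
  stieltjes (fun u => hazard F u ω) T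

/-- The integrand `X_u e^{-(Γ_u - Γ_t)}`. -/
def hazardIntegrand (F X : ℝ≥0 → Ω → ℝ) (t : ℝ≥0) (ω : Ω) (u : ℝ≥0) : ℝ :=
  X u ω * Real.exp (-(hazard F u ω - hazard F t ω))

/-- The pathwise integral `∫_t^T X_u e^{-(Γ_u - Γ_t)} dΓ_u`. -/
def hazardIntegral (F X : ℝ≥0 → Ω → ℝ) (t T : ℝ≥0) (ω : Ω) : ℝ :=
  ∫ u in Ioc t T, hazardIntegrand F X t ω u ∂(hazardMeasure F T ω)

/-- Almost surely, `∫_t^T X_u e^{-(Γ_u - Γ_t)} dΓ_u` converges absolutely. -/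
def HazardIntegrable (Q : Measure Ω) (F X : ℝ≥0 → Ω → ℝ) (t T : ℝ≥0) : Prop :=
  ∀ᵐ ω ∂Q, IntegrableOn (hazardIntegrand F X t ω) (Ioc t T) (hazardMeasure F T ω)

end RTFS

end

/-! The hazard integrals are conditional expectations of processes sampled at `τ`, written pathwise.
Suppose a Markov kernel `κ` is a conditional law of `τ` (capped beyond `T`) given `𝓕 T`, with
distribution function `F` on `[0,T]`; this is `IsHazardKernel`. Under (IND) it is the law of `τ`.
Under (H), for `A` in `𝓕 T` the martingale `E[1_A | 𝓕 u]` is also a martingale of the enlarged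
filtration, which makes `F_u` the conditional probability of `{τ ≤ u}` given all of `𝓕 T`. Since `F`
is continuous and below `1`, `e^{-Γ} dΓ = dF` pathwise, so a hazard integral is `(1 - F_t)⁻¹ ∫ X dκ`
over `(t,T]`.

On `{τ > t}` the sets of the enlarged σ-algebra are traces of sets of `𝓕 t` (`enlarged_trace`), so
it is enough to compare integrals over `A ∩ {τ > t}` with `A` in `𝓕 t`; on `{τ ≤ t}` the call is
already struck. The payoff splits at maturity. On `{t < τ ≤ T}` it is a forward start payoff sampled
at `τ`, which the disintegration turns into `E[1_A ∫ X_u dκ]`. On `{τ > T}` it is `(1 - α) ξ` with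
`ξ = B(t,T) S_T`, which carries the survival factor `1 - F_T`.

Under (H) the crux is `IsProjection.lintegral_eq`: because the distribution function of `κ` is
adapted, `X_u` may be replaced by `E[X_u | 𝓕 u]` under the integral. Applied to the forward payoffs
this gives `B(t,u) c(u,u,T)`. Applied to the constant process `ξ` it gives `B(t,u) S_u`, and writing
`1 - F_T = (1 - F_t) - (F_T - F_t)` yields the two terms with `1 - α`. The replacement is proved on
right-endpoint Riemann sums. As the supremum of the martingale `B(t,u) S_u` need not be integrable,
a bounded weight is inserted before refining the grid and removed afterwards by monotone
convergence.

Under (IND) the measure is deterministic: Fubini allows conditioning on `𝓕 t` for each fixed `u`,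
and `1 - F_T` is a constant. -/

namespace RTFS

set_option linter.unusedSectionVars false

noncomputable section

/-! ### Change of variables for Lebesgue–Stieltjes measures -/

/-- The image of `dg` under a continuous nondecreasing function `g` is Lebesgue measure. -/
theorem stieltjesFunction_map_restrict_Ioc (g : StieltjesFunction ℝ≥0) (hg : Continuous g)
    {a b : ℝ≥0} (hab : a ≤ b) :
    (g.measure.restrict (Ioc a b)).map g = volume.restrict (Ioc (g a) (g b)) := by
  have hfin : IsFiniteMeasure (g.measure.restrict (Ioc a b)) :=
    ⟨by rw [Measure.restrict_apply_univ, g.measure_Ioc]; exact ENNReal.ofReal_lt_top⟩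
  refine Measure.ext_of_Iic _ _ fun y => ?_
  rw [Measure.map_apply hg.measurable measurableSet_Iic,
    Measure.restrict_apply (hg.measurable measurableSet_Iic),
    Measure.restrict_apply measurableSet_Iic]
  rcases lt_or_ge y (g a) with h | h
  · have h1 : g ⁻¹' Iic y ∩ Ioc a b = ∅ := by
      ext u
      simp only [mem_inter_iff, mem_preimage, mem_Iic, mem_Ioc, mem_empty_iff_false, iff_false,
        not_and]
      intro hu h2 _
      exact absurd (g.mono h2.le) (by linarith)
    have h2 : Iic y ∩ Ioc (g a) (g b) = ∅ := by
      ext u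
      simp only [mem_inter_iff, mem_Iic, mem_Ioc, mem_empty_iff_false, iff_false, not_and]
      intro hu h2
      linarith
    rw [h1, h2]; simp
  rcases le_or_gt (g b) y with h' | h'
  · have h1 : g ⁻¹' Iic y ∩ Ioc a b = Ioc a b :=
      inter_eq_right.2 fun u hu => (g.mono hu.2).trans h'
    have h2 : Iic y ∩ Ioc (g a) (g b) = Ioc (g a) (g b) :=
      inter_eq_right.2 fun u hu => hu.2.trans h'
    rw [h1, h2, g.measure_Ioc, Real.volume_Ioc]
  · have hK : IsCompact (Icc a b ∩ g ⁻¹' Iic y) :=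
      isCompact_Icc.inter_right (isClosed_Iic.preimage hg)
    -- The last point `s` of `[a,b]` with `g ≤ y` satisfies `g s = y` by the intermediate value
    -- theorem, so the preimage is `(a,s]`, of mass `y - g a`.
    obtain ⟨s, ⟨hs, hsy⟩, hmax⟩ := hK.exists_isGreatest ⟨a, ⟨le_rfl, hab⟩, h⟩
    have hgs : g s = y := by
      obtain ⟨s', hs', hy⟩ := intermediate_value_Icc hs.2 hg.continuousOn
        (show y ∈ Icc (g s) (g b) from ⟨hsy, h'.le⟩)
      have : s' ≤ s := hmax ⟨⟨hs.1.trans hs'.1, hs'.2⟩, hy.le⟩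
      rw [← hy, le_antisymm this hs'.1]
    have h1 : g ⁻¹' Iic y ∩ Ioc a b = Ioc a s := by
      ext u
      constructor
      · rintro ⟨hu, hu'⟩
        exact ⟨hu'.1, hmax ⟨⟨hu'.1.le, hu'.2⟩, hu⟩⟩
      · intro hu
        exact ⟨(g.mono hu.2).trans hsy, hu.1, hu.2.trans hs.2⟩
    have h2 : Iic y ∩ Ioc (g a) (g b) = Ioc (g a) y := by
      ext u
      simp only [mem_inter_iff, mem_Iic, mem_Ioc]
      constructor
      · rintro ⟨h1, h2, -⟩; exact ⟨h2, h1⟩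
      · rintro ⟨h1, h2⟩; exact ⟨h2, h1, h2.trans h'.le⟩
    rw [h1, h2, g.measure_Ioc, Real.volume_Ioc, hgs]

/-- Pushing forward by `g` reduces this to the Lebesgue integral of `e^{-y}` over `(g a, g b]`. -/
theorem lintegral_exp_neg_stieltjesFunction (g : StieltjesFunction ℝ≥0) (hg : Continuous g)
    {a b : ℝ≥0} (hab : a ≤ b) :
    ∫⁻ u in Ioc a b, ENNReal.ofReal (Real.exp (-g u)) ∂g.measure
      = ENNReal.ofReal (Real.exp (-g a) - Real.exp (-g b)) := by
  have hm : Measurable fun y : ℝ => ENNReal.ofReal (Real.exp (-y)) := by fun_prop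
  rw [← lintegral_map hm hg.measurable, stieltjesFunction_map_restrict_Ioc g hg hab]
  have hint : IntegrableOn (fun y : ℝ => Real.exp (-y)) (Ioc (g a) (g b)) :=
    (Continuous.integrableOn_Icc (by fun_prop)).mono_set Ioc_subset_Icc_self
  rw [← ofReal_integral_eq_lintegral_ofReal hint (ae_of_all _ fun y => (Real.exp_pos _).le),
    ← intervalIntegral.integral_of_le (g.mono hab)]
  congr 1
  rw [intervalIntegral.integral_eq_sub_of_hasDerivAt (f := fun y => -Real.exp (-y))]
  · ring
  · intro x _
    exact (hasDerivAt_neg x).exp.neg.congr_deriv (by simp)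
  · exact Continuous.intervalIntegrable (by fun_prop) _ _

/-- If `f` is the distribution function on `[0,T]` of a finite measure `μ`, continuous and less than
`1`, then `e^{-g} dg = dμ` on `(t,T]` for `g = -log (1 - f)`. -/
theorem stieltjes_withDensity {f : ℝ≥0 → ℝ} {T : ℝ≥0} {μ : Measure ℝ≥0} [IsFiniteMeasure μ]
    (hμ : ∀ u ≤ T, f u = μ.real (Iic u)) (hcont : ContinuousOn f (Iic T))
    (hlt : ∀ u ≤ T, f u < 1) (t : ℝ≥0) :
    ((stieltjes (fun u => -Real.log (1 - f u)) T).restrict (Ioc t T)).withDensity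
      (fun u => ENNReal.ofReal (1 - f (min u T))) = μ.restrict (Ioc t T) := by
  set g : ℝ≥0 → ℝ := fun u => -Real.log (1 - f (min u T)) with hgdef
  have hmin : ∀ u, min u T ≤ T := fun u => min_le_right _ _
  have hpos : ∀ u, 0 < 1 - f (min u T) := fun u => by linarith [hlt _ (hmin u)]
  have hfmono : Monotone fun u => f (min u T) := fun u v huv => by
    simp only [hμ _ (hmin u), hμ _ (hmin v)]
    exact measureReal_mono (Iic_subset_Iic.2 (min_le_min_right _ huv))
  have hgmono : Monotone g := fun u v huv =>
    neg_le_neg (Real.log_le_log (hpos v) (by linarith [hfmono huv]))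
  have hfc : Continuous fun u => f (min u T) :=
    hcont.comp_continuous (by fun_prop) fun u => hmin u
  have hgc : Continuous g :=
    ((continuous_const.sub hfc).log fun u => (hpos u).ne').neg
  have hst : stieltjes (fun u => -Real.log (1 - f u)) T = hgmono.stieltjesFunction.measure := by
    rw [stieltjes, dif_pos hgmono]
  -- The Stieltjes function of a monotone function takes right limits; continuity makes this
  -- harmless.
  have hG : (hgmono.stieltjesFunction : ℝ≥0 → ℝ) = g := by
    ext u
    rw [hgmono.stieltjesFunction_eq]
    exact hgc.continuousAt.continuousWithinAt.rightLim_eq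
  have hexp : ∀ u, Real.exp (-g u) = 1 - f (min u T) := fun u => by
    simp only [hgdef, neg_neg, Real.exp_log (hpos u)]
  rw [hst]
  have hIoc : ∀ a b, b ≤ T → (hgmono.stieltjesFunction.measure).withDensity
      (fun u => ENNReal.ofReal (1 - f (min u T))) (Ioc a b) = μ (Ioc a b) := by
    intro a b hb
    rcases lt_or_ge b a with h | hab
    · rw [Ioc_eq_empty (by exact not_lt.2 h.le)]; simp
    rw [withDensity_apply _ measurableSet_Ioc]
    have := lintegral_exp_neg_stieltjesFunction hgmono.stieltjesFunction (by rw [hG]; exact hgc) hab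
    simp only [hG, hexp] at this
    rw [this, min_eq_left hb, min_eq_left (hab.trans hb), hμ b hb, hμ a (hab.trans hb),
      ← ofReal_measureReal (measure_ne_top μ (Ioc a b)), ← Iic_sdiff_Iic,
      measureReal_sdiff (Iic_subset_Iic.2 hab) measurableSet_Iic]
    congr 1; ring
  rw [← restrict_withDensity measurableSet_Ioc]
  have hfin : IsFiniteMeasure ((hgmono.stieltjesFunction.measure.withDensity
      fun u => ENNReal.ofReal (1 - f (min u T))).restrict (Ioc t T)) :=
    ⟨by rw [Measure.restrict_apply_univ, hIoc t T le_rfl]; exact measure_lt_top _ _⟩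
  refine Measure.ext_of_Iic _ _ fun y => ?_
  rw [Measure.restrict_apply measurableSet_Iic, Measure.restrict_apply measurableSet_Iic,
    show Iic y ∩ Ioc t T = Ioc t (min y T) by ext; simp; tauto]
  exact hIoc _ _ (min_le_right _ _)

noncomputable section
variable {f : ℝ≥0 → ℝ} {T : ℝ≥0} {μ : Measure ℝ≥0} [IsFiniteMeasure μ]

theorem exp_hazard_sub {t u : ℝ≥0} (hlt : ∀ u ≤ T, f u < 1) (ht : t ≤ T) (hu : u ≤ T) :
    Real.exp (-(-Real.log (1 - f u) - -Real.log (1 - f t))) = (1 - f t)⁻¹ * (1 - f u) := by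
  have h1 : 0 < 1 - f u := by linarith [hlt u hu]
  have h2 : 0 < 1 - f t := by linarith [hlt t ht]
  rw [show -(-Real.log (1 - f u) - -Real.log (1 - f t)) = Real.log (1 - f u) - Real.log (1 - f t) by
    ring, Real.exp_sub, Real.exp_log h1, Real.exp_log h2]
  ring

theorem measurable_one_sub_stopped (hcont : ContinuousOn f (Iic T)) :
    Measurable fun u => ENNReal.ofReal (1 - f (min u T)) := by
  have hfc : Continuous fun u => f (min u T) :=
    hcont.comp_continuous (by fun_prop) fun u => mem_Iic.2 (min_le_right _ _)
  exact (measurable_const.sub hfc.measurable).ennreal_ofReal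

theorem integrableOn_stieltjes (hμ : ∀ u ≤ T, f u = μ.real (Iic u))
    (hcont : ContinuousOn f (Iic T)) (hlt : ∀ u ≤ T, f u < 1) {t : ℝ≥0} (ht : t ≤ T)
    {X : ℝ≥0 → ℝ} (hX : IntegrableOn X (Ioc t T) μ) :
    IntegrableOn (fun u => X u * Real.exp (-(-Real.log (1 - f u) - -Real.log (1 - f t))))
      (Ioc t T) (stieltjes (fun u => -Real.log (1 - f u)) T) := by
  rw [IntegrableOn, ← stieltjes_withDensity hμ hcont hlt t,
    integrable_withDensity_iff_integrable_smul' (measurable_one_sub_stopped hcont)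
      (ae_of_all _ fun _ => ENNReal.ofReal_lt_top)] at hX
  refine (hX.const_mul (1 - f t)⁻¹).congr ?_
  filter_upwards [ae_restrict_mem measurableSet_Ioc] with u hu
  have h1 : 0 < 1 - f u := by linarith [hlt u hu.2]
  rw [exp_hazard_sub hlt ht hu.2, min_eq_left hu.2, ENNReal.toReal_ofReal h1.le, smul_eq_mul]
  ring

/-- The factor `e^{-Γ_u}` converts `dΓ` into `μ`, and `e^{Γ_t} = (1 - f t)⁻¹` remains. -/
theorem integral_stieltjes (hμ : ∀ u ≤ T, f u = μ.real (Iic u))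
    (hcont : ContinuousOn f (Iic T)) (hlt : ∀ u ≤ T, f u < 1) {t : ℝ≥0} (ht : t ≤ T)
    (X : ℝ≥0 → ℝ) :
    ∫ u in Ioc t T, X u * Real.exp (-(-Real.log (1 - f u) - -Real.log (1 - f t)))
      ∂(stieltjes (fun u => -Real.log (1 - f u)) T) = (1 - f t)⁻¹ * ∫ u in Ioc t T, X u ∂μ := by
  rw [← stieltjes_withDensity hμ hcont hlt t,
    integral_withDensity_eq_integral_toReal_smul (measurable_one_sub_stopped hcont)
      (ae_of_all _ fun _ => ENNReal.ofReal_lt_top), ← integral_const_mul]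
  refine setIntegral_congr_fun measurableSet_Ioc fun u hu => ?_
  have h1 : 0 < 1 - f u := by linarith [hlt u hu.2]
  simp only [exp_hazard_sub hlt ht hu.2, min_eq_left hu.2, ENNReal.toReal_ofReal h1.le, smul_eq_mul]
  ring

end

/-! ### Discretization of time from the right -/

/-- The grid `k / (n+1)`, stopped at `T`. -/
def gridPoint (T : ℝ≥0) (n k : ℕ) : ℝ≥0 := min (k / (n + 1)) T

/-- The index of the first grid point to the right of `u`. -/
def gridIndex (n : ℕ) (u : ℝ≥0) : ℕ := ⌈u * (n + 1)⌉₊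

theorem gridPoint_le (T : ℝ≥0) (n k : ℕ) : gridPoint T n k ≤ T := min_le_right _ _

theorem measurable_gridIndex (n : ℕ) : Measurable (gridIndex n) :=
  Nat.measurable_ceil.comp (measurable_id.mul_const _)

theorem le_gridPoint {T u : ℝ≥0} (hu : u ≤ T) (n : ℕ) : u ≤ gridPoint T n (gridIndex n u) := by
  refine le_min ?_ hu
  rw [le_div_iff₀ (by positivity)]
  exact Nat.le_ceil _

/-- Since the approximation is exact at `T`, right-continuity of the projection is only needed
before `T`. -/
theorem gridPoint_self (T : ℝ≥0) (n : ℕ) : gridPoint T n (gridIndex n T) = T :=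
  le_antisymm (gridPoint_le _ _ _) (le_gridPoint le_rfl n)

theorem gridPoint_gridIndex_le (T u : ℝ≥0) (n : ℕ) :
    gridPoint T n (gridIndex n u) ≤ u + 1 / (n + 1) := by
  refine (min_le_left _ _).trans ?_
  rw [div_le_iff₀ (by positivity), add_mul, one_div, inv_mul_cancel₀ (by positivity)]
  exact (Nat.ceil_lt_add_one zero_le).le

theorem tendsto_gridPoint {T u : ℝ≥0} (hu : u ≤ T) :
    Tendsto (fun n => gridPoint T n (gridIndex n u)) atTop (𝓝[≥] u) := by
  refine tendsto_nhdsWithin_iff.2 ⟨?_, Eventually.of_forall fun n => le_gridPoint hu n⟩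
  refine tendsto_of_tendsto_of_tendsto_of_le_of_le tendsto_const_nhds ?_
    (fun n => le_gridPoint hu n) (fun n => gridPoint_gridIndex_le T u n)
  simpa using tendsto_const_nhds.add (tendsto_one_div_add_atTop_nhds_zero_nat (𝕜 := ℝ≥0))

/-- Each cell ends at the grid point where processes are sampled, so for an adapted distribution
function its mass is known at the sampling time. -/
theorem gridIndex_cell (t T : ℝ≥0) (n k : ℕ) :
    Ioc t T ∩ gridIndex n ⁻¹' {k}
      = Ioc (max t ((k - 1 : ℕ) / (n + 1))) (gridPoint T n k) := by
  ext u
  have hn : (0 : ℝ≥0) < n + 1 := by positivity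
  simp only [mem_inter_iff, mem_Ioc, mem_preimage, mem_singleton_iff, gridPoint, max_lt_iff,
    le_min_iff, gridIndex]
  -- Index `0` occurs only at `u = 0`, which is not beyond `t`; with the truncated `k - 1 = 0` the
  -- right-hand side is empty as well.
  rcases Nat.eq_zero_or_pos k with rfl | hk
  · simp only [Nat.ceil_eq_zero, nonpos_iff_eq_zero, mul_eq_zero, hn.ne', or_false]
    constructor
    · rintro ⟨⟨h1, -⟩, rfl⟩; exact absurd h1 (not_lt.2 zero_le)
    · rintro ⟨⟨h1, -⟩, h2, -⟩
      simp only [Nat.cast_zero, zero_div, nonpos_iff_eq_zero] at h2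
      subst h2; exact absurd h1 (not_lt.2 zero_le)
  · rw [Nat.ceil_eq_iff hk.ne', div_lt_iff₀ hn, le_div_iff₀ hn]
    tauto

/-- A right-continuous process is jointly measurable. -/
theorem measurable_uncurry_of_rightCts {Ω : Type*} [MeasurableSpace Ω] {X : ℝ≥0 → Ω → ℝ} {T : ℝ≥0}
    (hX : ∀ u ≤ T, Measurable (X u))
    (hcts : ∀ ω, ∀ u ≤ T, ContinuousWithinAt (fun v => X v ω) (Ici u) u) :
    Measurable fun p : Ω × ℝ≥0 => X (min p.2 T) p.1 := by
  refine measurable_of_tendsto_metrizable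
    (f := fun n (p : Ω × ℝ≥0) => X (gridPoint T n (gridIndex n (min p.2 T))) p.1) (fun n => ?_) ?_
  · have h : Measurable fun q : Ω × ℕ => X (gridPoint T n q.2) q.1 :=
      measurable_from_prod_countable_left fun k => hX _ (gridPoint_le _ _ _)
    have h' : Measurable fun p : Ω × ℝ≥0 => (p.1, gridIndex n (min p.2 T)) :=
      measurable_fst.prodMk
        ((measurable_gridIndex n).comp (measurable_snd.min measurable_const))
    simpa only [Function.comp_def] using h.comp h'
  · refine tendsto_pi_nhds.2 fun p => ?_
    exact (hcts p.1 _ (min_le_right _ _)).tendsto.comp (tendsto_gridPoint (min_le_right _ _))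

end

noncomputable section

/-! ### Integrals against a random measure and projections -/

/-- Pull out the bounded `m`-measurable factor `V` and take means. The form with `∫⁻` suits the
later dominated and monotone limits. -/
theorem lintegral_ofReal_mul_condExp {Ω : Type*} {m m₀ : MeasurableSpace Ω} {Q : Measure Ω}
    [IsFiniteMeasure Q] (hm : m ≤ m₀) {X Y V : Ω → ℝ} (hX : Integrable X Q) (hX0 : 0 ≤ᵐ[Q] X)
    (hY : Y =ᵐ[Q] Q[X | m]) (hV : AEStronglyMeasurable[m] V Q) {C : ℝ}
    (hV0 : ∀ᵐ ω ∂Q, 0 ≤ V ω) (hVC : ∀ᵐ ω ∂Q, V ω ≤ C) :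
    ∫⁻ ω, ENNReal.ofReal (X ω * V ω) ∂Q = ∫⁻ ω, ENNReal.ofReal (Y ω * V ω) ∂Q := by
  have hb : ∀ᵐ ω ∂Q, ‖V ω‖ ≤ C := by
    filter_upwards [hV0, hVC] with ω h0 h1
    rwa [Real.norm_of_nonneg h0]
  have hXV : Integrable (X * V) Q := hX.mul_bdd (hV.mono hm) hb
  have hY0 : 0 ≤ᵐ[Q] Y := (condExp_nonneg hX0).trans_eq hY.symm
  have hYi : Integrable Y Q := integrable_condExp.congr hY.symm
  have hYV : Integrable (Y * V) Q := hYi.mul_bdd (hV.mono hm) hb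
  have h1 : Q[X * V | m] =ᵐ[Q] Y * V :=
    (condExp_mul_of_aestronglyMeasurable_right hV hXV hX).trans (hY.symm.mul EventuallyEq.rfl)
  have h2 : ∫ ω, (X * V) ω ∂Q = ∫ ω, (Y * V) ω ∂Q := by
    rw [← integral_condExp hm, integral_congr_ae h1]
  have e1 := ofReal_integral_eq_lintegral_ofReal hXV
    (by filter_upwards [hX0, hV0] with ω h h'; exact mul_nonneg h h')
  have e2 := ofReal_integral_eq_lintegral_ofReal hYV
    (by filter_upwards [hY0, hV0] with ω h h'; exact mul_nonneg h h')
  rw [h2, e2] at e1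
  exact e1.symm

variable {Ω : Type*} [m : MeasurableSpace Ω]

theorem setLIntegral_gridIndex (μ : Measure ℝ≥0) (t T : ℝ≥0) (n : ℕ) (g : ℕ → ℝ≥0∞) :
    ∫⁻ u in Ioc t T, g (gridIndex n u) ∂μ
      = ∑' k, g k * μ (Ioc (max t ((k - 1 : ℕ) / (n + 1))) (gridPoint T n k)) := by
  rw [← lintegral_map (f := g) measurable_from_nat (measurable_gridIndex n), lintegral_countable']
  refine tsum_congr fun k => ?_
  rw [Measure.map_apply (measurable_gridIndex n) (measurableSet_singleton _),
    Measure.restrict_apply (measurable_gridIndex n (measurableSet_singleton _)), inter_comm,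
    gridIndex_cell]

/-! ### Riemann sums against a random measure -/

section Riemann

variable {Q : Measure Ω} {κ : Kernel Ω ℝ≥0} [IsMarkovKernel κ] {t T : ℝ≥0} {G : ℝ≥0 → Ω → ℝ≥0∞}

theorem aemeasurable_cell (hG : ∀ u ∈ Icc t T, AEMeasurable (G u) Q) (n k : ℕ) :
    AEMeasurable (fun ω => G (gridPoint T n k) ω *
      κ ω (Ioc (max t ((k - 1 : ℕ) / (n + 1))) (gridPoint T n k))) Q := by
  rcases le_or_gt t (gridPoint T n k) with h | h
  -- Cells whose grid point lies before `t` are empty, so measurability of `G` is only needed on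
  -- `[t,T]`.
  · exact (hG _ ⟨h, gridPoint_le _ _ _⟩).mul (κ.measurable_coe measurableSet_Ioc).aemeasurable
  · rw [Ioc_eq_empty (not_lt.2 (h.le.trans (le_max_left _ _)))]
    simp

theorem aemeasurable_setLIntegral_grid (hG : ∀ u ∈ Icc t T, AEMeasurable (G u) Q) (n : ℕ) :
    AEMeasurable (fun ω => ∫⁻ u in Ioc t T, G (gridPoint T n (gridIndex n u)) ω ∂κ ω) Q := by
  simp_rw [fun ω => setLIntegral_gridIndex (κ ω) t T n fun k => G (gridPoint T n k) ω]
  exact AEMeasurable.tsum fun k => aemeasurable_cell hG n k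

theorem lintegral_setLIntegral_grid (hG : ∀ u ∈ Icc t T, AEMeasurable (G u) Q) (n : ℕ) :
    ∫⁻ ω, ∫⁻ u in Ioc t T, G (gridPoint T n (gridIndex n u)) ω ∂κ ω ∂Q
      = ∑' k, ∫⁻ ω, G (gridPoint T n k) ω *
          κ ω (Ioc (max t ((k - 1 : ℕ) / (n + 1))) (gridPoint T n k)) ∂Q := by
  simp_rw [fun ω => setLIntegral_gridIndex (κ ω) t T n fun k => G (gridPoint T n k) ω]
  exact lintegral_tsum fun k => aemeasurable_cell hG n k

theorem aemeasurable_of_tendsto_grid {g : ℝ≥0 → ℝ≥0∞} (μ : Measure ℝ≥0)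
    (hg : ∀ u ∈ Ioc t T, Tendsto (fun n => g (gridPoint T n (gridIndex n u))) atTop (𝓝 (g u))) :
    AEMeasurable g (μ.restrict (Ioc t T)) := by
  refine aemeasurable_of_tendsto_metrizable_ae atTop
    (f := fun n u => g (gridPoint T n (gridIndex n u))) (fun n => ?_) ?_
  · exact ((measurable_from_nat (f := fun k => g (gridPoint T n k))).comp
      (measurable_gridIndex n)).aemeasurable
  · filter_upwards [ae_restrict_mem measurableSet_Ioc] with u hu using hg u hu

theorem ae_tendsto_setLIntegral_grid {b : Ω → ℝ≥0∞} (hb : ∀ᵐ ω ∂Q, b ω ≠ ∞)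
    (hGb : ∀ᵐ ω ∂Q, ∀ n, ∀ u ∈ Ioc t T, G (gridPoint T n (gridIndex n u)) ω ≤ b ω)
    (hGt : ∀ᵐ ω ∂Q, ∀ u ∈ Ioc t T,
      Tendsto (fun n => G (gridPoint T n (gridIndex n u)) ω) atTop (𝓝 (G u ω))) :
    ∀ᵐ ω ∂Q, Tendsto (fun n => ∫⁻ u in Ioc t T, G (gridPoint T n (gridIndex n u)) ω ∂κ ω) atTop
      (𝓝 (∫⁻ u in Ioc t T, G u ω ∂κ ω)) := by
  filter_upwards [hb, hGb, hGt] with ω h1 h2 h3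
  refine tendsto_lintegral_of_dominated_convergence' (fun _ => b ω) (fun n => ?_) (fun n => ?_) ?_ ?_
  · exact ((measurable_from_nat (f := fun k => G (gridPoint T n k) ω)).comp
      (measurable_gridIndex n)).aemeasurable
  · filter_upwards [ae_restrict_mem measurableSet_Ioc] with u hu using h2 n u hu
  · rw [lintegral_const]
    exact ENNReal.mul_ne_top h1 (measure_ne_top _ _)
  · filter_upwards [ae_restrict_mem measurableSet_Ioc] with u hu using h3 u hu

theorem aemeasurable_setLIntegral (hG : ∀ u ∈ Icc t T, AEMeasurable (G u) Q)
    {b : Ω → ℝ≥0∞} (hb : ∀ᵐ ω ∂Q, b ω ≠ ∞)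
    (hGb : ∀ᵐ ω ∂Q, ∀ n, ∀ u ∈ Ioc t T, G (gridPoint T n (gridIndex n u)) ω ≤ b ω)
    (hGt : ∀ᵐ ω ∂Q, ∀ u ∈ Ioc t T,
      Tendsto (fun n => G (gridPoint T n (gridIndex n u)) ω) atTop (𝓝 (G u ω))) :
    AEMeasurable (fun ω => ∫⁻ u in Ioc t T, G u ω ∂κ ω) Q :=
  aemeasurable_of_tendsto_metrizable_ae atTop (aemeasurable_setLIntegral_grid hG)
    (ae_tendsto_setLIntegral_grid hb hGb hGt)

/-- Dominated convergence is used twice: in `u` with the constant `b ω`, as `κ ω` has mass one, and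
then in `ω` with `b`. -/
theorem tendsto_lintegral_setLIntegral_grid (hG : ∀ u ∈ Icc t T, AEMeasurable (G u) Q)
    {b : Ω → ℝ≥0∞} (hb : ∫⁻ ω, b ω ∂Q ≠ ∞) (hbm : AEMeasurable b Q)
    (hGb : ∀ᵐ ω ∂Q, ∀ n, ∀ u ∈ Ioc t T, G (gridPoint T n (gridIndex n u)) ω ≤ b ω)
    (hGt : ∀ᵐ ω ∂Q, ∀ u ∈ Ioc t T,
      Tendsto (fun n => G (gridPoint T n (gridIndex n u)) ω) atTop (𝓝 (G u ω))) :
    Tendsto (fun n => ∫⁻ ω, ∫⁻ u in Ioc t T, G (gridPoint T n (gridIndex n u)) ω ∂κ ω ∂Q) atTop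
      (𝓝 (∫⁻ ω, ∫⁻ u in Ioc t T, G u ω ∂κ ω ∂Q)) := by
  refine tendsto_lintegral_of_dominated_convergence' b
    (aemeasurable_setLIntegral_grid hG) (fun n => ?_) hb
    (ae_tendsto_setLIntegral_grid ((ae_lt_top' hbm hb).mono fun _ h => h.ne) hGb hGt)
  filter_upwards [hGb] with ω h
  calc ∫⁻ u in Ioc t T, G (gridPoint T n (gridIndex n u)) ω ∂κ ω
      ≤ ∫⁻ _ in Ioc t T, b ω ∂κ ω := setLIntegral_mono measurable_const fun u hu => h n u hu
    _ ≤ b ω := by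
      rw [lintegral_const, Measure.restrict_apply_univ]
      exact mul_le_of_le_one_right' prob_le_one

end Riemann

/-- On `[t,T]`, the process `Y` is the projection `Y_u = E[X_u | 𝓕_u]` of a right-continuous process
`0 ≤ X ≤ ξ`, and `M` is the martingale closed by `ξ`. -/
structure IsProjection (Q : Measure Ω) (𝓕 : Filtration ℝ≥0 m) (t T : ℝ≥0) (ξ : Ω → ℝ)
    (X Y M : ℝ≥0 → Ω → ℝ) : Prop where
  integrable : Integrable ξ Q
  measurable : ∀ u ∈ Icc t T, Measurable (X u)
  nonneg : ∀ u ω, 0 ≤ X u ω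
  le : ∀ u ω, X u ω ≤ ξ ω
  rightCts : ∀ ω, ∀ u ∈ Icc t T, ContinuousWithinAt (fun v => X v ω) (Ici u) u
  martingale_meas : ∀ u ∈ Icc t T, StronglyMeasurable[𝓕 u] (M u)
  martingale_nonneg : ∀ u ω, 0 ≤ M u ω
  martingale_rightCts : ∀ ω, ∀ u ∈ Icc t T, ContinuousWithinAt (fun v => M v ω) (Ici u) u
  martingale_version : ∀ u ∈ Icc t T, M u =ᵐ[Q] Q[ξ | 𝓕 u]
  version : ∀ u ∈ Icc t T, Y u =ᵐ[Q] Q[X u | 𝓕 u]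
  proj_rightCts : ∀ᵐ ω ∂Q, ∀ u < T, ContinuousWithinAt (fun v => Y v ω) (Ici u) u

/-- A bounded weight, increasing to `w` with `k`, which makes `M` bounded. -/
def weight (w : Ω → ℝ) (M : ℝ≥0 → Ω → ℝ) (k : ℕ) (u : ℝ≥0) (ω : Ω) : ℝ :=
  min (w ω) (k + 1) * ((k + 1) / (k + 1 + M u ω))

/-! ### Replacing a process by its projection under the random measure -/

namespace IsProjection

variable {Q : Measure Ω} [IsProbabilityMeasure Q] {𝓕 : Filtration ℝ≥0 m} {t T : ℝ≥0} {ξ : Ω → ℝ}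
  {X Y M : ℝ≥0 → Ω → ℝ} {κ : Kernel Ω ℝ≥0} [IsMarkovKernel κ] {w : Ω → ℝ}

theorem integrable_process (h : IsProjection Q 𝓕 t T ξ X Y M) {u : ℝ≥0} (hu : u ∈ Icc t T) :
    Integrable (X u) Q :=
  h.integrable.mono' (h.measurable u hu).aestronglyMeasurable
    (ae_of_all _ fun ω => by rw [Real.norm_of_nonneg (h.nonneg u ω)]; exact h.le u ω)

theorem gridPoint_mem {u : ℝ≥0} (hu : u ∈ Ioc t T) (n : ℕ) :
    gridPoint T n (gridIndex n u) ∈ Icc t T :=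
  ⟨hu.1.le.trans (le_gridPoint hu.2 n), gridPoint_le _ _ _⟩

/-- For a fixed time these are inequalities between conditional expectations. Only countably many
grid points occur, so one null set serves them all. -/
theorem ae_grid_bounds (h : IsProjection Q 𝓕 t T ξ X Y M) :
    ∀ᵐ ω ∂Q, ∀ n, ∀ u ∈ Ioc t T, 0 ≤ Y (gridPoint T n (gridIndex n u)) ω ∧
      Y (gridPoint T n (gridIndex n u)) ω ≤ M (gridPoint T n (gridIndex n u)) ω := by
  have : ∀ᵐ ω ∂Q, ∀ n k, gridPoint T n k ∈ Icc t T →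
      0 ≤ Y (gridPoint T n k) ω ∧ Y (gridPoint T n k) ω ≤ M (gridPoint T n k) ω := by
    refine ae_all_iff.2 fun n => ae_all_iff.2 fun k => ?_
    by_cases hk : gridPoint T n k ∈ Icc t T
    · have h0 : 0 ≤ᵐ[Q] Q[X (gridPoint T n k) | 𝓕 (gridPoint T n k)] :=
        condExp_nonneg (ae_of_all _ fun ω => h.nonneg _ ω)
      have h1 : Q[X (gridPoint T n k) | 𝓕 (gridPoint T n k)] ≤ᵐ[Q] Q[ξ | 𝓕 (gridPoint T n k)] :=
        condExp_mono (h.integrable_process hk) h.integrable (ae_of_all _ fun ω => h.le _ ω)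
      filter_upwards [h0, h1, h.version _ hk, h.martingale_version _ hk] with ω a b c d _
      rw [c, d]
      exact ⟨a, b⟩
    · exact ae_of_all _ fun ω hk' => absurd hk' hk
  filter_upwards [this] with ω hω n u hu
  exact hω n _ (gridPoint_mem hu n)

theorem tendsto_grid (h : IsProjection Q 𝓕 t T ξ X Y M) (ω : Ω) {u : ℝ≥0} (hu : u ∈ Ioc t T) :
    Tendsto (fun n => X (gridPoint T n (gridIndex n u)) ω) atTop (𝓝 (X u ω)) :=
  (h.rightCts ω u ⟨hu.1.le, hu.2⟩).tendsto.comp (tendsto_gridPoint hu.2)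

theorem martingale_tendsto_grid (h : IsProjection Q 𝓕 t T ξ X Y M) (ω : Ω) {u : ℝ≥0}
    (hu : u ∈ Ioc t T) :
    Tendsto (fun n => M (gridPoint T n (gridIndex n u)) ω) atTop (𝓝 (M u ω)) :=
  (h.martingale_rightCts ω u ⟨hu.1.le, hu.2⟩).tendsto.comp (tendsto_gridPoint hu.2)

theorem proj_tendsto_grid (h : IsProjection Q 𝓕 t T ξ X Y M) :
    ∀ᵐ ω ∂Q, ∀ u ∈ Ioc t T,
      Tendsto (fun n => Y (gridPoint T n (gridIndex n u)) ω) atTop (𝓝 (Y u ω)) := by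
  filter_upwards [h.proj_rightCts] with ω hω u hu
  rcases hu.2.eq_or_lt with rfl | hlt
  · simp only [gridPoint_self]
    exact tendsto_const_nhds
  · exact (hω u hlt).tendsto.comp (tendsto_gridPoint hu.2)

/-- Right-continuity carries the bounds from the grid to all times. -/
theorem ae_bounds (h : IsProjection Q 𝓕 t T ξ X Y M) :
    ∀ᵐ ω ∂Q, ∀ u ∈ Ioc t T, 0 ≤ Y u ω ∧ Y u ω ≤ M u ω := by
  filter_upwards [h.ae_grid_bounds, h.proj_tendsto_grid] with ω h1 h2 u hu
  exact ⟨ge_of_tendsto' (h2 u hu) fun n => (h1 n u hu).1,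
    le_of_tendsto_of_tendsto' (h2 u hu) (h.martingale_tendsto_grid ω hu) fun n => (h1 n u hu).2⟩

theorem aemeasurable_proj (h : IsProjection Q 𝓕 t T ξ X Y M) {u : ℝ≥0} (hu : u ∈ Icc t T) :
    AEMeasurable (Y u) Q :=
  (integrable_condExp.congr (h.version u hu).symm).aemeasurable

theorem weight_nonneg (h : IsProjection Q 𝓕 t T ξ X Y M) (hw0 : ∀ ω, 0 ≤ w ω) (k : ℕ) (u : ℝ≥0)
    (ω : Ω) : 0 ≤ weight w M k u ω := by
  have := h.martingale_nonneg u ω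
  have := hw0 ω
  unfold weight
  positivity

theorem weight_le (h : IsProjection Q 𝓕 t T ξ X Y M) (hw0 : ∀ ω, 0 ≤ w ω) (k : ℕ) (u : ℝ≥0)
    (ω : Ω) : weight w M k u ω ≤ k + 1 := by
  have h1 := h.martingale_nonneg u ω
  have := hw0 ω
  have hk : (0 : ℝ) < k + 1 := by positivity
  have h2 : (k + 1 : ℝ) / (k + 1 + M u ω) ≤ 1 := by
    rw [div_le_one (by positivity)]; linarith
  calc weight w M k u ω ≤ (k + 1) * 1 :=
        mul_le_mul (min_le_right _ _) h2 (by positivity) hk.le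
    _ = k + 1 := mul_one _

/-- This is the purpose of the weight: with `Y ≤ M` it bounds the weighted projection by a constant,
which serves as dominating function where the supremum of `M` may fail to be integrable. -/
theorem martingale_mul_weight_le (h : IsProjection Q 𝓕 t T ξ X Y M) (hw0 : ∀ ω, 0 ≤ w ω) (k : ℕ)
    (u : ℝ≥0) (ω : Ω) : M u ω * weight w M k u ω ≤ (k + 1) * (k + 1) := by
  have h1 := h.martingale_nonneg u ω
  have := hw0 ω
  have hk : (0 : ℝ) < k + 1 := by positivity
  have h2 : M u ω * ((k + 1 : ℝ) / (k + 1 + M u ω)) ≤ k + 1 := by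
    rw [← mul_div_assoc, div_le_iff₀ (by positivity)]
    nlinarith
  calc M u ω * weight w M k u ω
      = min (w ω) (k + 1) * (M u ω * ((k + 1 : ℝ) / (k + 1 + M u ω))) := by unfold weight; ring
    _ ≤ _ := mul_le_mul (min_le_right _ _) h2 (by positivity) hk.le

theorem weight_mono (h : IsProjection Q 𝓕 t T ξ X Y M) (hw0 : ∀ ω, 0 ≤ w ω) (u : ℝ≥0)
    (ω : Ω) : Monotone fun k => weight w M k u ω := by
  intro k l hkl
  have h1 := h.martingale_nonneg u ω
  have := hw0 ω
  have hkl' : (k : ℝ) ≤ l := by exact_mod_cast hkl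
  refine mul_le_mul (min_le_min_left _ (by linarith)) ?_ (by positivity) (by positivity)
  rw [div_le_div_iff₀ (by positivity) (by positivity)]
  nlinarith

theorem weight_tendsto (h : IsProjection Q 𝓕 t T ξ X Y M) (u : ℝ≥0)
    (ω : Ω) : Tendsto (fun k => weight w M k u ω) atTop (𝓝 (w ω)) := by
  have h1 := h.martingale_nonneg u ω
  have hk : Tendsto (fun k : ℕ => (k : ℝ) + 1) atTop atTop :=
    tendsto_atTop_add_const_right _ _ tendsto_natCast_atTop_atTop
  have h2 : Tendsto (fun k : ℕ => min (w ω) ((k : ℝ) + 1)) atTop (𝓝 (w ω)) := by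
    refine tendsto_const_nhds.congr' ?_
    filter_upwards [hk.eventually_ge_atTop (w ω)] with k hk
    rw [min_eq_left hk]
  have h3 : Tendsto (fun k : ℕ => ((k : ℝ) + 1) / (k + 1 + M u ω)) atTop (𝓝 1) := by
    have : Tendsto (fun k : ℕ => 1 - M u ω / (k + 1 + M u ω)) atTop (𝓝 (1 - 0)) :=
      tendsto_const_nhds.sub
        (tendsto_const_nhds.div_atTop (tendsto_atTop_add_const_right _ _ hk))
    rw [sub_zero] at this
    refine this.congr fun k => ?_
    have : (k : ℝ) + 1 + M u ω ≠ 0 := by positivity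
    field_simp
    ring
  simpa [weight] using h2.mul h3

theorem weight_tendsto_grid (h : IsProjection Q 𝓕 t T ξ X Y M) (k : ℕ) (ω : Ω) {u : ℝ≥0}
    (hu : u ∈ Ioc t T) :
    Tendsto (fun n => weight w M k (gridPoint T n (gridIndex n u)) ω) atTop
      (𝓝 (weight w M k u ω)) := by
  have h1 := h.martingale_nonneg u ω
  exact tendsto_const_nhds.mul (tendsto_const_nhds.div
    (tendsto_const_nhds.add (h.martingale_tendsto_grid ω hu)) (by positivity))

theorem weight_aestronglyMeasurable (h : IsProjection Q 𝓕 t T ξ X Y M)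
    (hw : AEStronglyMeasurable[𝓕 t] w Q) (k : ℕ) {u : ℝ≥0} (hu : u ∈ Icc t T) :
    AEStronglyMeasurable[𝓕 u] (weight w M k u) Q := by
  have h1 : AEStronglyMeasurable[𝓕 u] (fun ω => min (w ω) ((k : ℝ) + 1)) Q :=
    (continuous_id.min continuous_const).comp_aestronglyMeasurable (hw.mono (𝓕.mono hu.1))
  have h2 : StronglyMeasurable[𝓕 u] fun ω => ((k : ℝ) + 1) / (k + 1 + M u ω) :=
    (measurable_const.div
      (measurable_const.add (h.martingale_meas u hu).measurable)).stronglyMeasurable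
  exact h1.mul h2.aestronglyMeasurable

theorem aemeasurable_ofReal_mul_weight (h : IsProjection Q 𝓕 t T ξ X Y M)
    (hw : AEStronglyMeasurable[𝓕 t] w Q) (k : ℕ) {Z : ℝ≥0 → Ω → ℝ}
    (hZ : ∀ u ∈ Icc t T, AEMeasurable (Z u) Q) (u : ℝ≥0) (hu : u ∈ Icc t T) :
    AEMeasurable (fun ω => ENNReal.ofReal (Z u ω * weight w M k u ω)) Q :=
  ((hZ u hu).mul
    ((h.weight_aestronglyMeasurable hw k hu).mono (𝓕.le u)).aemeasurable).ennreal_ofReal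

theorem proj_weight_grid_le (h : IsProjection Q 𝓕 t T ξ X Y M) (hw0 : ∀ ω, 0 ≤ w ω) (k : ℕ) :
    ∀ᵐ ω ∂Q, ∀ n, ∀ u ∈ Ioc t T, ENNReal.ofReal (Y (gridPoint T n (gridIndex n u)) ω *
      weight w M k (gridPoint T n (gridIndex n u)) ω) ≤ ENNReal.ofReal ((k + 1) * (k + 1)) := by
  filter_upwards [h.ae_grid_bounds] with ω hω n u hu
  exact ENNReal.ofReal_le_ofReal ((mul_le_mul_of_nonneg_right (hω n u hu).2
    (h.weight_nonneg hw0 k _ ω)).trans (h.martingale_mul_weight_le hw0 k _ ω))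

theorem proj_weight_tendsto_grid (h : IsProjection Q 𝓕 t T ξ X Y M) (k : ℕ) :
    ∀ᵐ ω ∂Q, ∀ u ∈ Ioc t T, Tendsto (fun n => ENNReal.ofReal (Y (gridPoint T n (gridIndex n u)) ω *
      weight w M k (gridPoint T n (gridIndex n u)) ω)) atTop
      (𝓝 (ENNReal.ofReal (Y u ω * weight w M k u ω))) := by
  filter_upwards [h.proj_tendsto_grid] with ω hω u hu
  exact ENNReal.tendsto_ofReal ((hω u hu).mul (h.weight_tendsto_grid k ω hu))

/-- The weighted processes `X` and `Y` have the same integral against the random measure. -/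
theorem lintegral_weight (h : IsProjection Q 𝓕 t T ξ X Y M)
    (hκ : ∀ a, ∀ b ≤ T, AEStronglyMeasurable[𝓕 b] (fun ω => (κ ω).real (Ioc a b)) Q)
    (hw : AEStronglyMeasurable[𝓕 t] w Q) (hw0 : ∀ ω, 0 ≤ w ω) (k : ℕ) :
    ∫⁻ ω, ∫⁻ u in Ioc t T, ENNReal.ofReal (X u ω * weight w M k u ω) ∂κ ω ∂Q
      = ∫⁻ ω, ∫⁻ u in Ioc t T, ENNReal.ofReal (Y u ω * weight w M k u ω) ∂κ ω ∂Q := by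
  have mX := h.aemeasurable_ofReal_mul_weight hw k fun u hu => (h.measurable u hu).aemeasurable
  have mY := h.aemeasurable_ofReal_mul_weight hw k fun u hu => h.aemeasurable_proj hu
  have limX := tendsto_lintegral_setLIntegral_grid (κ := κ) (Q := Q)
    (G := fun u ω => ENNReal.ofReal (X u ω * weight w M k u ω))
    (b := fun ω => ENNReal.ofReal (ξ ω * (k + 1))) mX
    (h.integrable.mul_const _).lintegral_lt_top.ne
    (h.integrable.aemeasurable.mul_const _).ennreal_ofReal
    (ae_of_all _ fun ω n _ _ => ENNReal.ofReal_le_ofReal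
      (mul_le_mul (h.le _ ω) (h.weight_le hw0 k _ ω) (h.weight_nonneg hw0 k _ ω)
        ((h.nonneg t ω).trans (h.le t ω))))
    (ae_of_all _ fun ω u hu =>
      ENNReal.tendsto_ofReal ((h.tendsto_grid ω hu).mul (h.weight_tendsto_grid k ω hu)))
  have limY := tendsto_lintegral_setLIntegral_grid (κ := κ) (Q := Q)
    (G := fun u ω => ENNReal.ofReal (Y u ω * weight w M k u ω))
    (b := fun _ => ENNReal.ofReal ((k + 1) * (k + 1))) mY
    (by rw [lintegral_const, measure_univ, mul_one]; exact ENNReal.ofReal_ne_top)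
    aemeasurable_const (h.proj_weight_grid_le hw0 k) (h.proj_weight_tendsto_grid k)
  -- Both sides are limits of grid sums, so it suffices to compare them cell by cell at each level
  -- `n`.
  refine tendsto_nhds_unique limX (limY.congr fun n => ?_)
  rw [lintegral_setLIntegral_grid mX, lintegral_setLIntegral_grid mY]
  refine tsum_congr fun j => ?_
  set r := gridPoint T n j
  set a := max t (((j - 1 : ℕ) : ℝ≥0) / (n + 1))
  rcases lt_or_ge r t with hr | hr
  · rw [Ioc_eq_empty (not_lt.2 (hr.le.trans (le_max_left _ _)))]
    simp
  have hrm : r ∈ Icc t T := ⟨hr, gridPoint_le _ _ _⟩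
  -- At the right endpoint `r` of the cell, both the weight and the mass of `(a,r]` are `𝓕
  -- r`-measurable, so `X r` may be replaced by its conditional expectation `Y r`.
  have key := lintegral_ofReal_mul_condExp (𝓕.le r) (h.integrable_process hrm)
    (ae_of_all _ fun ω => h.nonneg r ω) (h.version r hrm)
    (V := fun ω => weight w M k r ω * (κ ω).real (Ioc a r))
    ((h.weight_aestronglyMeasurable hw k hrm).mul (hκ a r hrm.2)) (C := k + 1)
    (ae_of_all _ fun ω => mul_nonneg (h.weight_nonneg hw0 k r ω) measureReal_nonneg)
    (ae_of_all _ fun ω => (mul_le_of_le_one_right (h.weight_nonneg hw0 k r ω)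
      measureReal_le_one).trans (h.weight_le hw0 k r ω))
  have e : ∀ (Z : Ω → ℝ) ω, ENNReal.ofReal (Z ω * (weight w M k r ω * (κ ω).real (Ioc a r)))
      = ENNReal.ofReal (Z ω * weight w M k r ω) * κ ω (Ioc a r) := fun Z ω => by
    rw [← mul_assoc, ENNReal.ofReal_mul' measureReal_nonneg, ofReal_measureReal]
  simp only [e] at key
  exact key.symm

theorem monotone_weight_mul (h : IsProjection Q 𝓕 t T ξ X Y M) (hw0 : ∀ ω, 0 ≤ w ω) {z : ℝ}
    (hz : 0 ≤ z) (u : ℝ≥0) (ω : Ω) : Monotone fun k => ENNReal.ofReal (z * weight w M k u ω) :=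
  fun _ _ hkl => ENNReal.ofReal_le_ofReal
    (mul_le_mul_of_nonneg_left (h.weight_mono hw0 u ω hkl) hz)

theorem tendsto_weight_mul (h : IsProjection Q 𝓕 t T ξ X Y M) (z : ℝ) (u : ℝ≥0) (ω : Ω) :
    Tendsto (fun k => ENNReal.ofReal (z * weight w M k u ω)) atTop (𝓝 (ENNReal.ofReal (z * w ω))) :=
  ENNReal.tendsto_ofReal (tendsto_const_nhds.mul (h.weight_tendsto u ω))

theorem aemeasurable_process_weight (h : IsProjection Q 𝓕 t T ξ X Y M) (ω : Ω) (k : ℕ) :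
    AEMeasurable (fun u => ENNReal.ofReal (X u ω * weight w M k u ω)) ((κ ω).restrict (Ioc t T)) :=
  aemeasurable_of_tendsto_grid _ fun _ hu =>
    ENNReal.tendsto_ofReal ((h.tendsto_grid ω hu).mul (h.weight_tendsto_grid k ω hu))

theorem aemeasurable_proj_weight (h : IsProjection Q 𝓕 t T ξ X Y M) (k : ℕ) :
    ∀ᵐ ω ∂Q, AEMeasurable (fun u => ENNReal.ofReal (Y u ω * weight w M k u ω))
      ((κ ω).restrict (Ioc t T)) := by
  filter_upwards [h.proj_weight_tendsto_grid k] with ω hω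
  exact aemeasurable_of_tendsto_grid _ hω

theorem aemeasurable_setLIntegral_proj_weight (h : IsProjection Q 𝓕 t T ξ X Y M)
    (hw : AEStronglyMeasurable[𝓕 t] w Q) (hw0 : ∀ ω, 0 ≤ w ω) (k : ℕ) :
    AEMeasurable
      (fun ω => ∫⁻ u in Ioc t T, ENNReal.ofReal (Y u ω * weight w M k u ω) ∂κ ω) Q :=
  aemeasurable_setLIntegral
    (h.aemeasurable_ofReal_mul_weight hw k fun _ hu => h.aemeasurable_proj hu)
    (b := fun _ => ENNReal.ofReal ((k + 1) * (k + 1)))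
    (ae_of_all _ fun _ => ENNReal.ofReal_ne_top)
    (h.proj_weight_grid_le hw0 k) (h.proj_weight_tendsto_grid k)

theorem ae_tendsto_setLIntegral_proj_weight (h : IsProjection Q 𝓕 t T ξ X Y M)
    (hw0 : ∀ ω, 0 ≤ w ω) :
    ∀ᵐ ω ∂Q, Tendsto
      (fun k => ∫⁻ u in Ioc t T, ENNReal.ofReal (Y u ω * weight w M k u ω) ∂κ ω) atTop
      (𝓝 (∫⁻ u in Ioc t T, ENNReal.ofReal (Y u ω * w ω) ∂κ ω)) := by
  have hm := ae_all_iff.2 fun k => h.aemeasurable_proj_weight (κ := κ) (w := w) k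
  filter_upwards [hm, h.ae_bounds] with ω h1 h2
  refine lintegral_tendsto_of_tendsto_of_monotone h1 ?_ ?_
  · filter_upwards [ae_restrict_mem measurableSet_Ioc] with u hu
    exact h.monotone_weight_mul hw0 (h2 u hu).1 u ω
  · exact ae_of_all _ fun u => h.tendsto_weight_mul _ u ω

theorem aemeasurable_setLIntegral_proj (h : IsProjection Q 𝓕 t T ξ X Y M)
    (hw : AEStronglyMeasurable[𝓕 t] w Q) (hw0 : ∀ ω, 0 ≤ w ω) :
    AEMeasurable (fun ω => ∫⁻ u in Ioc t T, ENNReal.ofReal (Y u ω * w ω) ∂κ ω) Q :=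
  aemeasurable_of_tendsto_metrizable_ae atTop
    (h.aemeasurable_setLIntegral_proj_weight hw hw0) (h.ae_tendsto_setLIntegral_proj_weight hw0)

/-- A right-continuous process and its projection have the same weighted integral against a random
measure whose distribution function is adapted. -/
theorem lintegral_eq (h : IsProjection Q 𝓕 t T ξ X Y M)
    (hκ : ∀ a, ∀ b ≤ T, AEStronglyMeasurable[𝓕 b] (fun ω => (κ ω).real (Ioc a b)) Q)
    (hw : AEStronglyMeasurable[𝓕 t] w Q) (hw0 : ∀ ω, 0 ≤ w ω) :
    ∫⁻ ω, ∫⁻ u in Ioc t T, ENNReal.ofReal (X u ω * w ω) ∂κ ω ∂Q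
      = ∫⁻ ω, ∫⁻ u in Ioc t T, ENNReal.ofReal (Y u ω * w ω) ∂κ ω ∂Q := by
  have limX : Tendsto
      (fun k => ∫⁻ ω, ∫⁻ u in Ioc t T, ENNReal.ofReal (X u ω * weight w M k u ω) ∂κ ω ∂Q) atTop
      (𝓝 (∫⁻ ω, ∫⁻ u in Ioc t T, ENNReal.ofReal (X u ω * w ω) ∂κ ω ∂Q)) := by
    refine lintegral_tendsto_of_tendsto_of_monotone (fun k => ?_) ?_ ?_
    · exact aemeasurable_setLIntegral
        (h.aemeasurable_ofReal_mul_weight hw k fun u hu => (h.measurable u hu).aemeasurable)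
        (b := fun ω => ENNReal.ofReal (ξ ω * (k + 1)))
        (ae_of_all _ fun _ => ENNReal.ofReal_ne_top)
        (ae_of_all _ fun ω n _ _ => ENNReal.ofReal_le_ofReal
          (mul_le_mul (h.le _ ω) (h.weight_le hw0 k _ ω) (h.weight_nonneg hw0 k _ ω)
            ((h.nonneg t ω).trans (h.le t ω))))
        (ae_of_all _ fun ω u hu =>
          ENNReal.tendsto_ofReal ((h.tendsto_grid ω hu).mul (h.weight_tendsto_grid k ω hu)))
    · exact ae_of_all _ fun ω k l hkl => lintegral_mono fun _ =>
        h.monotone_weight_mul hw0 (h.nonneg _ ω) _ ω hkl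
    · exact ae_of_all _ fun ω => lintegral_tendsto_of_tendsto_of_monotone
        (fun k => h.aemeasurable_process_weight ω k)
        (ae_of_all _ fun u => h.monotone_weight_mul hw0 (h.nonneg u ω) u ω)
        (ae_of_all _ fun u => h.tendsto_weight_mul _ u ω)
  have limY : Tendsto
      (fun k => ∫⁻ ω, ∫⁻ u in Ioc t T, ENNReal.ofReal (Y u ω * weight w M k u ω) ∂κ ω ∂Q) atTop
      (𝓝 (∫⁻ ω, ∫⁻ u in Ioc t T, ENNReal.ofReal (Y u ω * w ω) ∂κ ω ∂Q)) := by
    refine lintegral_tendsto_of_tendsto_of_monotone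
      (h.aemeasurable_setLIntegral_proj_weight hw hw0) ?_
      (h.ae_tendsto_setLIntegral_proj_weight hw0)
    filter_upwards [h.ae_bounds] with ω h2 k l hkl
    exact setLIntegral_mono' measurableSet_Ioc fun u hu =>
      h.monotone_weight_mul hw0 (h2 u hu).1 u ω hkl
  exact tendsto_nhds_unique limX (limY.congr fun k => (h.lintegral_weight hκ hw hw0 k).symm)

theorem lintegral_process_lt_top (h : IsProjection Q 𝓕 t T ξ X Y M) (hw0 : ∀ ω, 0 ≤ w ω) {C : ℝ}
    (hC : ∀ᵐ ω ∂Q, w ω * (κ ω).real (Ioc t T) ≤ C) :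
    ∫⁻ ω, ∫⁻ u in Ioc t T, ENNReal.ofReal (X u ω * w ω) ∂κ ω ∂Q < ∞ := by
  calc ∫⁻ ω, ∫⁻ u in Ioc t T, ENNReal.ofReal (X u ω * w ω) ∂κ ω ∂Q
      ≤ ∫⁻ ω, ENNReal.ofReal (ξ ω * C) ∂Q := by
        refine lintegral_mono_ae ?_
        filter_upwards [hC] with ω hω
        have hξ : 0 ≤ ξ ω := (h.nonneg t ω).trans (h.le t ω)
        calc ∫⁻ u in Ioc t T, ENNReal.ofReal (X u ω * w ω) ∂κ ω
            ≤ ∫⁻ _ in Ioc t T, ENNReal.ofReal (ξ ω * w ω) ∂κ ω :=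
              lintegral_mono fun u => ENNReal.ofReal_le_ofReal
                (mul_le_mul_of_nonneg_right (h.le u ω) (hw0 ω))
          _ = ENNReal.ofReal (ξ ω * (w ω * (κ ω).real (Ioc t T))) := by
              rw [lintegral_const, Measure.restrict_apply_univ, ← mul_assoc,
                ENNReal.ofReal_mul' measureReal_nonneg, ofReal_measureReal]
          _ ≤ _ := ENNReal.ofReal_le_ofReal (mul_le_mul_of_nonneg_left hω hξ)
    _ < ∞ := (h.integrable.mul_const C).lintegral_lt_top

theorem aestronglyMeasurable_proj_path (h : IsProjection Q 𝓕 t T ξ X Y M) :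
    ∀ᵐ ω ∂Q, ∀ μ : Measure ℝ≥0, AEStronglyMeasurable (fun u => Y u ω) (μ.restrict (Ioc t T)) := by
  filter_upwards [h.proj_tendsto_grid] with ω hω μ
  refine aestronglyMeasurable_of_tendsto_ae atTop
    (f := fun n u => Y (gridPoint T n (gridIndex n u)) ω) (fun n => ?_) ?_
  · exact ((measurable_from_nat (f := fun k => Y (gridPoint T n k) ω)).comp
      (measurable_gridIndex n)).aestronglyMeasurable
  · filter_upwards [ae_restrict_mem measurableSet_Ioc] with u hu using hω u hu

/-- With `w = 1`, `lintegral_eq` shows that the pathwise integral of `Y` has finite mean, hence is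
finite almost surely. -/
theorem integrableOn_proj_path (h : IsProjection Q 𝓕 t T ξ X Y M)
    (hκ : ∀ a, ∀ b ≤ T, AEStronglyMeasurable[𝓕 b] (fun ω => (κ ω).real (Ioc a b)) Q) :
    ∀ᵐ ω ∂Q, IntegrableOn (fun u => Y u ω) (Ioc t T) (κ ω) := by
  have h1 : AEStronglyMeasurable[𝓕 t] (fun _ : Ω => (1 : ℝ)) Q := aestronglyMeasurable_const
  have hlt := h.lintegral_process_lt_top (κ := κ) (w := fun _ => 1) (fun _ => zero_le_one) (C := 1)
    (ae_of_all _ fun ω => by rw [one_mul]; exact measureReal_le_one)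
  rw [h.lintegral_eq hκ h1 fun _ => zero_le_one] at hlt
  filter_upwards [ae_lt_top' (h.aemeasurable_setLIntegral_proj h1 fun _ => zero_le_one) hlt.ne,
    h.aestronglyMeasurable_proj_path, h.ae_bounds] with ω a b c
  refine ⟨b _, ?_⟩
  rw [hasFiniteIntegral_iff_ofReal]
  · simpa using a
  · filter_upwards [ae_restrict_mem measurableSet_Ioc] with u hu using (c u hu).1

theorem setLIntegral_proj_eq (h : IsProjection Q 𝓕 t T ξ X Y M)
    (hκ : ∀ a, ∀ b ≤ T, AEStronglyMeasurable[𝓕 b] (fun ω => (κ ω).real (Ioc a b)) Q)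
    (hw0 : ∀ ω, 0 ≤ w ω) :
    ∀ᵐ ω ∂Q, ∫⁻ u in Ioc t T, ENNReal.ofReal (Y u ω * w ω) ∂κ ω
      = ENNReal.ofReal (w ω * ∫ u in Ioc t T, Y u ω ∂κ ω) := by
  filter_upwards [h.integrableOn_proj_path hκ, h.ae_bounds] with ω a b
  rw [mul_comm, ← integral_mul_const, ofReal_integral_eq_lintegral_ofReal (a.mul_const _)]
  filter_upwards [ae_restrict_mem measurableSet_Ioc] with u hu
  exact mul_nonneg (b u hu).1 (hw0 ω)

theorem integral_proj_nonneg (h : IsProjection Q 𝓕 t T ξ X Y M) :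
    ∀ᵐ ω ∂Q, 0 ≤ ∫ u in Ioc t T, Y u ω ∂κ ω := by
  filter_upwards [h.ae_bounds] with ω b
  exact setIntegral_nonneg measurableSet_Ioc fun u hu => (b u hu).1

/-- The weighted pathwise integral of the projection is integrable, with the same mean as the one
of the process itself. -/
theorem integrable_proj (h : IsProjection Q 𝓕 t T ξ X Y M)
    (hκ : ∀ a, ∀ b ≤ T, AEStronglyMeasurable[𝓕 b] (fun ω => (κ ω).real (Ioc a b)) Q)
    (hw : AEStronglyMeasurable[𝓕 t] w Q) (hw0 : ∀ ω, 0 ≤ w ω) {C : ℝ}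
    (hC : ∀ᵐ ω ∂Q, w ω * (κ ω).real (Ioc t T) ≤ C) :
    Integrable (fun ω => w ω * ∫ u in Ioc t T, Y u ω ∂κ ω) Q ∧
    ENNReal.ofReal (∫ ω, w ω * ∫ u in Ioc t T, Y u ω ∂κ ω ∂Q)
      = ∫⁻ ω, ∫⁻ u in Ioc t T, ENNReal.ofReal (X u ω * w ω) ∂κ ω ∂Q := by
  have hnn : 0 ≤ᵐ[Q] fun ω => w ω * ∫ u in Ioc t T, Y u ω ∂κ ω := by
    filter_upwards [h.integral_proj_nonneg (κ := κ)] with ω hω using mul_nonneg (hw0 ω) hω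
  have hlt := h.lintegral_process_lt_top (κ := κ) hw0 hC
  have hm : AEMeasurable (fun ω => w ω * ∫ u in Ioc t T, Y u ω ∂κ ω) Q := by
    refine (h.aemeasurable_setLIntegral_proj (κ := κ) hw hw0).ennreal_toReal.congr ?_
    filter_upwards [h.setLIntegral_proj_eq hκ hw0, hnn] with ω a b
    rw [a, ENNReal.toReal_ofReal b]
  have e := h.lintegral_eq hκ hw hw0
  rw [e, lintegral_congr_ae (h.setLIntegral_proj_eq hκ hw0)] at hlt ⊢
  have hi : Integrable (fun ω => w ω * ∫ u in Ioc t T, Y u ω ∂κ ω) Q :=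
    ⟨hm.aestronglyMeasurable, (hasFiniteIntegral_iff_ofReal hnn).2 hlt⟩
  exact ⟨hi, ofReal_integral_eq_lintegral_ofReal hi hnn⟩

end IsProjection

end

noncomputable section

/-! ### Conditional expectations with respect to the enlarged filtration -/

theorem norm_condExp_indicator_le_one {Ω : Type*} {m m₀ : MeasurableSpace Ω} {Q : Measure Ω}
    [IsFiniteMeasure Q] (hm : m ≤ m₀) {B : Set Ω} (hB : MeasurableSet B) :
    ∀ᵐ ω ∂Q, ‖(Q[B.indicator (1 : Ω → ℝ) | m]) ω‖ ≤ 1 := by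
  have a : 0 ≤ᵐ[Q] Q[B.indicator (1 : Ω → ℝ) | m] :=
    condExp_nonneg (ae_of_all _ fun ω => indicator_nonneg (by simp) ω)
  have b : Q[B.indicator (1 : Ω → ℝ) | m] ≤ᵐ[Q] Q[fun _ => (1 : ℝ) | m] :=
    condExp_mono ((integrable_const (1 : ℝ)).indicator hB) (integrable_const _)
      (ae_of_all _ fun ω => indicator_le_self' (f := (1 : Ω → ℝ)) (by simp) ω)
  rw [condExp_const hm] at b
  filter_upwards [a, b] with ω h0 h1
  rwa [Real.norm_of_nonneg h0]

/-- Conditional expectation is self-adjoint: both sides are the mean of `E[f | m] E[1_B | m]`. -/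
theorem integral_condExp_mul_indicator {Ω : Type*} {m m₀ : MeasurableSpace Ω} {Q : Measure Ω}
    [IsFiniteMeasure Q] (hm : m ≤ m₀) {f : Ω → ℝ} (hf : Integrable f Q) {B : Set Ω}
    (hB : MeasurableSet B) :
    ∫ ω in B, (Q[f | m]) ω ∂Q = ∫ ω, f ω * (Q[B.indicator (1 : Ω → ℝ) | m]) ω ∂Q := by
  set V : Ω → ℝ := Q[B.indicator (1 : Ω → ℝ) | m]
  have h1 : Integrable (B.indicator (1 : Ω → ℝ)) Q := (integrable_const (1 : ℝ)).indicator hB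
  have hb : ∀ᵐ ω ∂Q, ‖V ω‖ ≤ 1 := norm_condExp_indicator_le_one hm hB
  have hVm : AEStronglyMeasurable V Q := integrable_condExp.aestronglyMeasurable
  have e1 : Q[f * V | m] =ᵐ[Q] Q[f | m] * V :=
    condExp_mul_of_stronglyMeasurable_right stronglyMeasurable_condExp (hf.mul_bdd hVm hb) hf
  have hi : Integrable (Q[f | m] * B.indicator (1 : Ω → ℝ)) Q :=
    integrable_condExp.mul_bdd h1.aestronglyMeasurable (c := 1)
      (ae_of_all _ fun ω => by by_cases h : ω ∈ B <;> simp [h])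
  have e2 : Q[Q[f | m] * B.indicator (1 : Ω → ℝ) | m] =ᵐ[Q] Q[f | m] * V :=
    condExp_mul_of_stronglyMeasurable_left stronglyMeasurable_condExp hi h1
  calc ∫ ω in B, (Q[f | m]) ω ∂Q = ∫ ω, (Q[f | m] * B.indicator (1 : Ω → ℝ)) ω ∂Q := by
        rw [← integral_indicator hB]
        refine integral_congr_ae (ae_of_all _ fun ω => ?_)
        by_cases h : ω ∈ B <;> simp [h]
    _ = ∫ ω, (Q[f | m] * V) ω ∂Q := by rw [← integral_condExp hm, integral_congr_ae e2]
    _ = ∫ ω, (f * V) ω ∂Q := by rw [← integral_congr_ae e1, integral_condExp hm]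

variable {Ω : Type*} [m : MeasurableSpace Ω]

theorem measurableSet_enlarged_le (𝓕 : Filtration ℝ≥0 m) {τ : Ω → ℝ≥0∞} (hτ : Measurable τ)
    (t : ℝ≥0) : MeasurableSet[enlarged 𝓕 τ hτ t] {ω | τ ω ≤ t} := by
  have h1 : occurrenceFiltration τ hτ t ≤ enlarged 𝓕 τ hτ t :=
    (le_sup_right : occurrenceFiltration τ hτ ≤ enlarged 𝓕 τ hτ) t
  refine h1 _ ?_
  have h2 : StronglyMeasurable[occurrenceFiltration τ hτ t] (occurrence τ t) :=
    Filtration.stronglyAdapted_natural _ t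
  have h3 : {ω | τ ω ≤ t} = occurrence τ t ⁻¹' {1} := by
    ext ω
    by_cases h : τ ω ≤ t <;> simp [occurrence, h]
  rw [h3]
  exact h2.measurable (measurableSet_singleton _)

theorem measurableSet_enlarged_lt (𝓕 : Filtration ℝ≥0 m) {τ : Ω → ℝ≥0∞} (hτ : Measurable τ)
    (t : ℝ≥0) : MeasurableSet[enlarged 𝓕 τ hτ t] {ω | (t : ℝ≥0∞) < τ ω} := by
  have := (measurableSet_enlarged_le 𝓕 hτ t).compl
  simpa [compl_ofPred] using this

/-- The σ-algebra of the sets whose trace on `E` is the trace of a set of `m'`. -/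
abbrev traceSpace (m' : MeasurableSpace Ω) (E : Set Ω) : MeasurableSpace Ω where
  MeasurableSet' G := ∃ A, MeasurableSet[m'] A ∧ G ∩ E = A ∩ E
  measurableSet_empty := ⟨∅, MeasurableSet.empty, rfl⟩
  measurableSet_compl := by
    rintro G ⟨A, hA, h⟩
    refine ⟨Aᶜ, hA.compl, ?_⟩
    ext ω
    have := Set.ext_iff.1 h ω
    simp only [mem_inter_iff, mem_compl_iff] at this ⊢
    tauto
  measurableSet_iUnion := by
    intro G hG
    choose A hA h using hG
    exact ⟨⋃ i, A i, MeasurableSet.iUnion hA, by rw [iUnion_inter, iUnion_inter]; simp only [h]⟩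

/-- Before the random time, the enlarged filtration carries the information of `𝓕` only. -/
theorem enlarged_trace (𝓕 : Filtration ℝ≥0 m) {τ : Ω → ℝ≥0∞} (hτ : Measurable τ) {t : ℝ≥0}
    {G : Set Ω} (hG : MeasurableSet[enlarged 𝓕 τ hτ t] G) :
    ∃ A, MeasurableSet[𝓕 t] A ∧ G ∩ {ω | (t : ℝ≥0∞) < τ ω} = A ∩ {ω | (t : ℝ≥0∞) < τ ω} := by
  have h : enlarged 𝓕 τ hτ t ≤ traceSpace (𝓕 t) {ω | (t : ℝ≥0∞) < τ ω} := by
    refine sup_le (fun A hA => ⟨A, hA, rfl⟩) ?_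
    refine iSup₂_le fun s hs => ?_
    rintro _ ⟨B, -, rfl⟩
    -- On `{t < τ}` the occurrence process vanishes at every `s ≤ t`, so the trace of a generator is
    -- everything or nothing, according to whether `0 ∈ B`.
    by_cases h0 : (0 : ℝ) ∈ B
    · refine ⟨univ, @MeasurableSet.univ _ (𝓕 t), ?_⟩
      ext ω
      simp only [mem_inter_iff, mem_preimage, mem_ofPred_eq, mem_univ, true_and,
        and_iff_right_iff_imp]
      intro hω
      have : ¬ τ ω ≤ s := not_le.2 (lt_of_le_of_lt (by exact_mod_cast hs) hω)
      simpa [occurrence, this] using h0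
    · refine ⟨∅, @MeasurableSet.empty _ (𝓕 t), ?_⟩
      ext ω
      simp only [mem_inter_iff, mem_preimage, mem_ofPred_eq, mem_empty_iff_false, false_and,
        iff_false, not_and]
      intro hω hω'
      have : ¬ τ ω ≤ s := not_le.2 (lt_of_le_of_lt (by exact_mod_cast hs) hω')
      exact h0 (by simpa [occurrence, this] using hω)
  exact h _ hG

/-- The conditional expectation with respect to the enlarged filtration, before the random time. -/
theorem indicator_condExp_enlarged {Q : Measure Ω} [IsFiniteMeasure Q] (𝓕 : Filtration ℝ≥0 m)
    {τ : Ω → ℝ≥0∞} (hτ : Measurable τ) {t : ℝ≥0} {P Z : Ω → ℝ} (hP : Integrable P Q)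
    (hZ : Integrable Z Q) (hZm : AEStronglyMeasurable[𝓕 t] Z Q)
    (h : ∀ A, MeasurableSet[𝓕 t] A → ∫ ω in A ∩ {ω | (t : ℝ≥0∞) < τ ω}, P ω ∂Q
      = ∫ ω in A ∩ {ω | (t : ℝ≥0∞) < τ ω}, Z ω ∂Q) :
    {ω | (t : ℝ≥0∞) < τ ω}.indicator (Q[P | enlarged 𝓕 τ hτ t])
      =ᵐ[Q] {ω | (t : ℝ≥0∞) < τ ω}.indicator Z := by
  set E := {ω | (t : ℝ≥0∞) < τ ω}
  have hE : MeasurableSet[enlarged 𝓕 τ hτ t] E := measurableSet_enlarged_lt 𝓕 hτ t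
  have hle := (enlarged 𝓕 τ hτ).le t
  have hE' : MeasurableSet E := hle _ hE
  refine (condExp_indicator hP hE).symm.trans ?_
  refine (ae_eq_condExp_of_forall_setIntegral_eq hle (hP.indicator hE')
    (fun s _ _ => (hZ.indicator hE').integrableOn) (fun s hs _ => ?_) ?_).symm
  · obtain ⟨A, hA, hAs⟩ := enlarged_trace 𝓕 hτ hs
    rw [setIntegral_indicator hE', setIntegral_indicator hE', hAs, h A hA]
  · have : 𝓕 t ≤ enlarged 𝓕 τ hτ t := (le_sup_left : 𝓕 ≤ enlarged 𝓕 τ hτ) t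
    exact ⟨E.indicator (hZm.mk Z), (hZm.stronglyMeasurable_mk.mono this).indicator hE,
      hZm.ae_eq_mk.mono fun ω hω => by by_cases hE : ω ∈ E <;> simp [hE, hω]⟩

/-! ### Conditional distribution of the random time -/

/-- The random time, made finite without changing it up to `T`. -/
def cappedTime (τ : Ω → ℝ≥0∞) (T : ℝ≥0) (ω : Ω) : ℝ≥0 := (min (τ ω) (T + 1 : ℝ≥0)).toNNReal

theorem measurable_cappedTime {τ : Ω → ℝ≥0∞} (hτ : Measurable τ) (T : ℝ≥0) :
    Measurable (cappedTime τ T) :=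
  (hτ.min measurable_const).ennreal_toNNReal

theorem cappedTime_le_iff {τ : Ω → ℝ≥0∞} {T u : ℝ≥0} (hu : u ≤ T) (ω : Ω) :
    cappedTime τ T ω ≤ u ↔ τ ω ≤ u := by
  have h1 : min (τ ω) (T + 1 : ℝ≥0) ≠ ∞ := (min_lt_of_right_lt ENNReal.coe_lt_top).ne
  rw [cappedTime, ← ENNReal.coe_le_coe, ENNReal.coe_toNNReal h1, min_le_iff, or_iff_left]
  rw [ENNReal.coe_le_coe, not_le]
  exact hu.trans_lt (lt_add_one T)

theorem cappedTime_eq {τ : Ω → ℝ≥0∞} {T : ℝ≥0} {ω : Ω} (h : τ ω ≤ T) :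
    cappedTime τ T ω = (τ ω).toNNReal := by
  rw [cappedTime, min_eq_left]
  exact h.trans (by exact_mod_cast (lt_add_one T).le)

theorem cappedTime_mem_Ioc {τ : Ω → ℝ≥0∞} {t T : ℝ≥0} (ht : t ≤ T) (ω : Ω) :
    cappedTime τ T ω ∈ Ioc t T ↔ (t : ℝ≥0∞) < τ ω ∧ τ ω ≤ T := by
  rw [mem_Ioc, cappedTime_le_iff le_rfl, ← not_le, cappedTime_le_iff ht, not_le]

/-- `κ` is a conditional distribution of the random time given `𝓕 T`, and it has distribution
function `F` on `[0,T]`. -/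
structure IsHazardKernel (Q : Measure Ω) (𝓕 : Filtration ℝ≥0 m) (τ : Ω → ℝ≥0∞) (T : ℝ≥0)
    (F : ℝ≥0 → Ω → ℝ) (κ : Kernel Ω ℝ≥0) : Prop where
  markov : IsMarkovKernel κ
  disintegration : ∀ f : Ω × ℝ≥0 → ℝ≥0∞, Measurable[(𝓕 T).prod inferInstance] f →
    ∫⁻ ω, f (ω, cappedTime τ T ω) ∂Q = ∫⁻ ω, ∫⁻ u, f (ω, u) ∂κ ω ∂Q
  distribution : ∀ᵐ ω ∂Q, ∀ u ≤ T, F u ω = (κ ω).real (Iic u)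

theorem tendsto_measureReal_Iic_grid (μ : Measure ℝ≥0) [IsFiniteMeasure μ] {u T : ℝ≥0}
    (hu : u ≤ T) :
    Tendsto (fun n => μ.real (Iic (gridPoint T n (gridIndex n u)))) atTop (𝓝 (μ.real (Iic u))) := by
  refine (ENNReal.tendsto_toReal (measure_ne_top _ _)).comp ?_
  refine tendsto_measure_of_tendsto_indicator_of_isFiniteMeasure atTop μ
    (fun _ => measurableSet_Iic) fun x => ?_
  have ht := tendsto_gridPoint hu
  rcases le_or_gt x u with h | h
  · exact Eventually.of_forall fun n => iff_of_true (h.trans (le_gridPoint hu n)) h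
  · filter_upwards [(tendsto_nhdsWithin_iff.1 ht).1.eventually_lt_const h] with n hn
    exact iff_of_false (not_le.2 hn) (not_le.2 h)

/-- Both sides are right-continuous in `u` along the grid, so agreement at the countably many grid
points gives a null set independent of `u`. -/
theorem distribution_of_ae {Q : Measure Ω} {𝓕 : Filtration ℝ≥0 m} {τ : Ω → ℝ≥0∞} {T : ℝ≥0}
    {F : ℝ≥0 → Ω → ℝ} (hF : IsCondDistribution Q 𝓕 τ T F) (κ : Kernel Ω ℝ≥0) [IsMarkovKernel κ]
    (h : ∀ u ≤ T, F u =ᵐ[Q] fun ω => (κ ω).real (Iic u)) :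
    ∀ᵐ ω ∂Q, ∀ u ≤ T, F u ω = (κ ω).real (Iic u) := by
  have h1 : ∀ᵐ ω ∂Q, ∀ n k, F (gridPoint T n k) ω = (κ ω).real (Iic (gridPoint T n k)) :=
    ae_all_iff.2 fun n => ae_all_iff.2 fun k => h _ (gridPoint_le _ _ _)
  filter_upwards [h1, hF.continuous] with ω h1 h2 u hu
  have h3 : Tendsto (fun n => gridPoint T n (gridIndex n u)) atTop (𝓝[Iic T] u) :=
    tendsto_nhdsWithin_iff.2 ⟨(tendsto_nhdsWithin_iff.1 (tendsto_gridPoint hu)).1,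
      Eventually.of_forall fun n => gridPoint_le _ _ _⟩
  have h4 := (h2 u hu).tendsto.comp h3
  refine tendsto_nhds_unique h4 ((tendsto_measureReal_Iic_grid (κ ω) hu).congr fun n => ?_)
  exact (h1 n _).symm

/-- Existence of regular conditional distributions, in the form of a disintegration. -/
theorem exists_disintegration {β : Type*} [MeasurableSpace β] (Q : Measure Ω)
    [IsProbabilityMeasure Q] {X : Ω → β} (hX : Measurable X) {σ : Ω → ℝ≥0} (hσ : Measurable σ) :
    ∃ κ : Kernel Ω ℝ≥0, IsMarkovKernel κ ∧
      (∀ s, MeasurableSet s → ∃ g : β → ℝ≥0∞, Measurable g ∧ ∀ ω, κ ω s = g (X ω)) ∧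
      ∀ f : β × ℝ≥0 → ℝ≥0∞, Measurable f →
        ∫⁻ ω, f (X ω, σ ω) ∂Q = ∫⁻ ω, ∫⁻ u, f (X ω, u) ∂κ ω ∂Q := by
  refine ⟨(condDistrib σ X Q).comap X hX, inferInstance,
    fun s hs => ⟨fun b => condDistrib σ X Q b s, Kernel.measurable_coe _ hs, fun _ => rfl⟩,
    fun f hf => ?_⟩
  simp only [Kernel.comap_apply]
  rw [← lintegral_map hf (hX.prodMk hσ), ← compProd_map_condDistrib hσ.aemeasurable,
    Measure.lintegral_compProd hf, lintegral_map hf.lintegral_kernel_prod_right' hX]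

theorem lintegral_of_indepFun {β : Type*} [MeasurableSpace β] (Q : Measure Ω)
    [IsProbabilityMeasure Q] {X : Ω → β} (hX : Measurable X) {σ : Ω → ℝ≥0} (hσ : Measurable σ)
    (h : IndepFun X σ Q) {f : β × ℝ≥0 → ℝ≥0∞} (hf : Measurable f) :
    ∫⁻ ω, f (X ω, σ ω) ∂Q = ∫⁻ ω, ∫⁻ u, f (X ω, u) ∂(Q.map σ) ∂Q := by
  have : IsProbabilityMeasure (Q.map σ) := Measure.isProbabilityMeasure_map hσ.aemeasurable
  rw [← lintegral_map hf (hX.prodMk hσ),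
    (indepFun_iff_map_prod_eq_prod_map_map hX.aemeasurable hσ.aemeasurable).1 h,
    lintegral_prod _ hf.aemeasurable, lintegral_map hf.lintegral_prod_right' hX]

/-! ### The conditional law of the random time under (H) and under (IND) -/

section Existence

variable {Q : Measure Ω} [IsProbabilityMeasure Q] {𝓕 : Filtration ℝ≥0 m} {τ : Ω → ℝ≥0∞}
  {hτ : Measurable τ} {T : ℝ≥0} {F : ℝ≥0 → Ω → ℝ}

/-- Under (H), `F_u` is the conditional probability of `{τ ≤ u}` given `𝓕 T`. -/
theorem HypothesisH.setIntegral_eq (hH : HypothesisH Q 𝓕 τ hτ)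
    (hF : IsCondDistribution Q 𝓕 τ T F) {u : ℝ≥0} (hu : u ≤ T) {A : Set Ω}
    (hA : MeasurableSet[𝓕 T] A) :
    ∫ ω in A, F u ω ∂Q = Q.real (A ∩ {ω | τ ω ≤ u}) := by
  have hA' : MeasurableSet A := 𝓕.le T _ hA
  have hB := measurableSet_enlarged_le 𝓕 hτ u
  have hB' : MeasurableSet {ω | τ ω ≤ u} := (enlarged 𝓕 τ hτ).le u _ hB
  have hAi : Integrable (A.indicator (1 : Ω → ℝ)) Q := (integrable_const (1 : ℝ)).indicator hA'
  have hBi : Integrable ({ω | τ ω ≤ u}.indicator (1 : Ω → ℝ)) Q :=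
    (integrable_const (1 : ℝ)).indicator hB'
  -- This martingale equals `1_A` at time `T`; (H) then identifies `E[1_A | 𝓕 u]` with the
  -- conditional expectation given the enlarged σ-algebra, to which `{τ ≤ u}` belongs.
  have hM := hH _ (martingale_condExp (A.indicator (1 : Ω → ℝ)) 𝓕 Q)
  have h1 : Q[A.indicator (1 : Ω → ℝ) | 𝓕 T] = A.indicator (1 : Ω → ℝ) :=
    condExp_of_stronglyMeasurable (𝓕.le T) (stronglyMeasurable_one.indicator hA) hAi
  have h2 := hM.2 u T hu
  simp only [h1] at h2
  have h3 : ∫ ω in A, F u ω ∂Q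
      = ∫ ω in A, (Q[{ω | τ ω ≤ u}.indicator (1 : Ω → ℝ) | 𝓕 u]) ω ∂Q := by
    refine setIntegral_congr_ae hA' ?_
    filter_upwards [hF.version u hu] with ω hω _
    exact hω
  -- Self-adjointness moves the conditioning from `{τ ≤ u}` to `A`, where (H) applies.
  rw [h3, integral_condExp_mul_indicator (𝓕.le u) hBi hA']
  calc ∫ ω, {ω | τ ω ≤ u}.indicator (1 : Ω → ℝ) ω * (Q[A.indicator (1 : Ω → ℝ) | 𝓕 u]) ω ∂Q
      = ∫ ω in {ω | τ ω ≤ u}, (Q[A.indicator (1 : Ω → ℝ) | 𝓕 u]) ω ∂Q := by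
        rw [← integral_indicator hB']
        refine integral_congr_ae (ae_of_all _ fun ω => ?_)
        by_cases h : τ ω ≤ u <;> simp [h]
    _ = ∫ ω in {ω | τ ω ≤ u}, (Q[A.indicator (1 : Ω → ℝ) | enlarged 𝓕 τ hτ u]) ω ∂Q :=
        setIntegral_congr_ae hB' (h2.mono fun ω hω _ => hω.symm)
    _ = ∫ ω in {ω | τ ω ≤ u}, A.indicator (1 : Ω → ℝ) ω ∂Q :=
        setIntegral_condExp ((enlarged 𝓕 τ hτ).le u) hAi hB
    _ = Q.real (A ∩ {ω | τ ω ≤ u}) := by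
        rw [setIntegral_indicator hA', inter_comm]
        simp [Measure.real]

theorem setIntegral_measureReal_Iic (hτ : Measurable τ) (κ : Kernel Ω ℝ≥0) [IsMarkovKernel κ]
    (hd' : ∀ f : Ω × ℝ≥0 → ℝ≥0∞, Measurable[(𝓕 T).prod inferInstance] f →
      ∫⁻ ω, f (ω, cappedTime τ T ω) ∂Q = ∫⁻ ω, ∫⁻ u, f (ω, u) ∂κ ω ∂Q)
    {u : ℝ≥0} (hu : u ≤ T) {A : Set Ω} (hA : MeasurableSet[𝓕 T] A) :
    ∫ ω in A, (κ ω).real (Iic u) ∂Q = Q.real (A ∩ {ω | τ ω ≤ u}) := by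
  have hA' : MeasurableSet A := 𝓕.le T _ hA
  have hτu : MeasurableSet {ω | τ ω ≤ u} := measurableSet_le hτ measurable_const
  have key : ∫⁻ ω, (A ×ˢ Iic u).indicator (1 : Ω × ℝ≥0 → ℝ≥0∞) (ω, cappedTime τ T ω) ∂Q
      = ∫⁻ ω, ∫⁻ v, (A ×ˢ Iic u).indicator (1 : Ω × ℝ≥0 → ℝ≥0∞) (ω, v) ∂κ ω ∂Q :=
    hd' _ ((@measurable_const _ _ _ ((𝓕 T).prod inferInstance) 1).indicator
      (@MeasurableSet.prod _ _ (𝓕 T) _ _ _ hA measurableSet_Iic))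
  have l1 : ∫⁻ ω, (A ×ˢ Iic u).indicator (1 : Ω × ℝ≥0 → ℝ≥0∞) (ω, cappedTime τ T ω) ∂Q
      = Q (A ∩ {ω | τ ω ≤ u}) := by
    rw [← lintegral_indicator_one (hA'.inter hτu)]
    refine lintegral_congr fun ω => ?_
    have := cappedTime_le_iff (τ := τ) hu ω
    by_cases h1 : ω ∈ A <;> by_cases h2 : τ ω ≤ u <;> simp [indicator, h1, h2, this]
  have l2 : ∫⁻ ω, ∫⁻ v, (A ×ˢ Iic u).indicator (1 : Ω × ℝ≥0 → ℝ≥0∞) (ω, v) ∂κ ω ∂Q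
      = ∫⁻ ω in A, κ ω (Iic u) ∂Q := by
    rw [← lintegral_indicator hA']
    refine lintegral_congr fun ω => ?_
    by_cases h : ω ∈ A
    · rw [indicator_of_mem h, ← lintegral_indicator_one measurableSet_Iic]
      refine lintegral_congr fun v => ?_
      simp [indicator, h]
    · rw [indicator_of_notMem h]
      simp [indicator, h]
  rw [l1, l2] at key
  rw [Measure.real, key]
  refine integral_toReal ?_ ?_
  · exact (κ.measurable_coe measurableSet_Iic).aemeasurable
  · exact ae_of_all _ fun ω => measure_lt_top _ _

theorem HypothesisH.exists_kernel (hH : HypothesisH Q 𝓕 τ hτ)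
    (hF : IsCondDistribution Q 𝓕 τ T F) : ∃ κ, IsHazardKernel Q 𝓕 τ T F κ := by
  -- Conditioning on the identity map from `(Ω, m)` to `(Ω, 𝓕 T)` is conditioning on the σ-algebra
  -- `𝓕 T`.
  obtain ⟨κ, hκ, hκm, hd'⟩ := @exists_disintegration Ω m Ω (𝓕 T) Q _ id
    (measurable_id'' (𝓕.le T)) _ (measurable_cappedTime hτ T)
  refine ⟨κ, hκ, hd', distribution_of_ae hF κ fun u hu => ?_⟩
  have hm : StronglyMeasurable[𝓕 T] fun ω => (κ ω).real (Iic u) := by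
    obtain ⟨g, hg, hgκ⟩ := hκm _ measurableSet_Iic
    rw [show (fun ω => (κ ω).real (Iic u)) = fun ω => (g ω).toReal from
      funext fun ω => congrArg ENNReal.toReal (hgκ ω)]
    exact hg.ennreal_toReal.stronglyMeasurable
  have hi : Integrable (fun ω => (κ ω).real (Iic u)) Q :=
    Integrable.of_bound (hm.mono (𝓕.le T)).aestronglyMeasurable 1
      (ae_of_all _ fun ω => by
        rw [Real.norm_of_nonneg measureReal_nonneg]; exact measureReal_le_one)
  have hFi : Integrable (F u) Q := integrable_condExp.congr (hF.version u hu).symm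
  have hFm : AEStronglyMeasurable[𝓕 T] (F u) Q :=
    ⟨_, stronglyMeasurable_condExp.mono (𝓕.mono hu), hF.version u hu⟩
  refine ae_eq_of_forall_setIntegral_eq_of_sigmaFinite' (𝓕.le T) (fun s _ _ => hFi.integrableOn)
    (fun s _ _ => hi.integrableOn) (fun A hA _ => ?_) hFm hm.aestronglyMeasurable
  rw [hH.setIntegral_eq hF hu hA]
  exact (setIntegral_measureReal_Iic hτ κ hd' hu hA).symm

/-- (IND) speaks of the σ-algebra of the occurrence process, so the capped time must be measurable
for it. Levels below the cap are read off the occurrence process; from the cap on, the event is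
certain. -/
theorem measurable_cappedTime_occurrence (hτ : Measurable τ) (T : ℝ≥0) :
    Measurable[⨆ s, occurrenceFiltration τ hτ s] (cappedTime τ T) := by
  refine @measurable_of_Iic _ _ _ _ _ (⨆ s, occurrenceFiltration τ hτ s) _ _ _ _ fun u => ?_
  rcases lt_or_ge u (T + 1) with hu | hu
  · have h1 : cappedTime τ T ⁻¹' Iic u = occurrence τ u ⁻¹' {1} := by
      ext ω
      have h2 : min (τ ω) (T + 1 : ℝ≥0) ≠ ∞ := (min_lt_of_right_lt ENNReal.coe_lt_top).ne
      have h3 : cappedTime τ T ω ≤ u ↔ τ ω ≤ u := by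
        rw [cappedTime, ← ENNReal.coe_le_coe, ENNReal.coe_toNNReal h2, min_le_iff, or_iff_left]
        rwa [ENNReal.coe_le_coe, not_le]
      by_cases h : τ ω ≤ u <;> simp [occurrence, h, h3]
    have h2 : StronglyMeasurable[occurrenceFiltration τ hτ u] (occurrence τ u) :=
      Filtration.stronglyAdapted_natural _ u
    rw [h1]
    exact le_iSup (fun s => (occurrenceFiltration τ hτ s : MeasurableSpace Ω)) u _
      (h2.measurable (measurableSet_singleton _))
  · have h1 : cappedTime τ T ⁻¹' Iic u = univ := by
      refine eq_univ_of_forall fun ω => le_trans ?_ hu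
      exact ENNReal.toNNReal_mono ENNReal.coe_ne_top (min_le_right _ _)
    rw [h1]
    exact @MeasurableSet.univ _ (⨆ s, occurrenceFiltration τ hτ s)

/-- Under (IND), the law of the random time is a conditional distribution. -/
theorem HypothesisIND.isHazardKernel (hI : HypothesisIND Q 𝓕 τ hτ)
    (hF : IsCondDistribution Q 𝓕 τ T F) :
    IsHazardKernel Q 𝓕 τ T F (Kernel.const Ω (Q.map (cappedTime τ T))) := by
  have hc := measurable_cappedTime hτ T
  have hc' := measurable_cappedTime_occurrence hτ T
  have hP : IsProbabilityMeasure (Q.map (cappedTime τ T)) :=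
    Measure.isProbabilityMeasure_map hc.aemeasurable
  have hH : ⨆ s, (occurrenceFiltration τ hτ s : MeasurableSpace Ω) ≤ m :=
    iSup_le fun s => (occurrenceFiltration τ hτ).le s
  have hind : ∀ u, Indep (𝓕 u) (⨆ s, occurrenceFiltration τ hτ s) Q := fun u =>
    indep_of_indep_of_le_left hI (le_iSup (fun s => (𝓕 s : MeasurableSpace Ω)) u)
  refine ⟨inferInstance, fun f hf => ?_, distribution_of_ae hF _ fun u hu => ?_⟩
  · refine @lintegral_of_indepFun Ω m Ω (𝓕 T) Q _ id (measurable_id'' (𝓕.le T)) _ hc ?_ f hf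
    refine (@IndepFun_iff_Indep _ _ _ _ (𝓕 T) _ _ _ _).2 ?_
    rw [@MeasurableSpace.comap_id _ (𝓕 T)]
    exact indep_of_indep_of_le_right (hind T) hc'.comap_le
  · have h1 : {ω | τ ω ≤ u} = cappedTime τ T ⁻¹' Iic u := by
      ext ω
      exact (cappedTime_le_iff hu ω).symm
    have h2 : StronglyMeasurable[⨆ s, occurrenceFiltration τ hτ s]
        ({ω | τ ω ≤ u}.indicator (1 : Ω → ℝ)) :=
      stronglyMeasurable_one.indicator (by rw [h1]; exact hc' measurableSet_Iic)
    refine (hF.version u hu).trans ?_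
    -- By independence the conditional probability given `𝓕 u` is the constant `Q(τ ≤ u)`.
    refine (condExp_indep_eq hH (𝓕.le u) h2 (hind u).symm).trans (ae_of_all _ fun ω => ?_)
    simp only [Kernel.const_apply]
    rw [map_measureReal_apply hc measurableSet_Iic, ← h1, integral_indicator_one]
    rw [h1]
    exact hc measurableSet_Iic

end Existence

end

noncomputable section

variable {Ω : Type*} [m : MeasurableSpace Ω]

/-! ### The market -/

section Market

variable {Q : Measure Ω} [IsProbabilityMeasure Q] {𝓕 : Filtration ℝ≥0 m} {D S : ℝ≥0 → Ω → ℝ}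
  {T : ℝ≥0} {α : ℝ}

/-- The discounted payoff at `t` of the forward start call with determination time `u`. -/
def forwardPayoff (D S : ℝ≥0 → Ω → ℝ) (T : ℝ≥0) (α : ℝ) (t u : ℝ≥0) (ω : Ω) : ℝ :=
  discount D t T ω * max (S T ω - α * S u ω) 0

theorem IsMarket.discount_pos' (hM : IsMarket Q 𝓕 D S T) (t u : ℝ≥0) (ω : Ω) :
    0 < discount D t u ω := div_pos (hM.discount_pos _ _) (hM.discount_pos _ _)

theorem IsMarket.stronglyMeasurable_discount (hM : IsMarket Q 𝓕 D S T) {t u v : ℝ≥0} (htv : t ≤ v)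
    (huv : u ≤ v) : StronglyMeasurable[𝓕 v] (discount D t u) :=
  (((hM.discount_adapted u).mono (𝓕.mono huv)).measurable.div
    ((hM.discount_adapted t).mono (𝓕.mono htv)).measurable).stronglyMeasurable

theorem IsMarket.forwardPayoff_nonneg (hM : IsMarket Q 𝓕 D S T) (t u : ℝ≥0) (ω : Ω) :
    0 ≤ forwardPayoff D S T α t u ω :=
  mul_nonneg (hM.discount_pos' t T ω).le (le_max_right _ _)

theorem IsMarket.forwardPayoff_le (hM : IsMarket Q 𝓕 D S T) (hα : 0 ≤ α) (t u : ℝ≥0) (ω : Ω) :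
    forwardPayoff D S T α t u ω ≤ discount D t T ω * S T ω := by
  refine mul_le_mul_of_nonneg_left (max_le ?_ (hM.asset_nonneg _ _)) (hM.discount_pos' t T ω).le
  have := mul_nonneg hα (hM.asset_nonneg u ω)
  linarith

theorem IsMarket.stronglyMeasurable_forwardPayoff (hM : IsMarket Q 𝓕 D S T) {t u : ℝ≥0}
    (ht : t ≤ T) (hu : u ≤ T) : StronglyMeasurable[𝓕 T] (forwardPayoff D S T α t u) := by
  have h1 : Measurable[𝓕 T] (S u) := ((hM.asset_adapted u).mono (𝓕.mono hu)).measurable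
  have h2 : Measurable[𝓕 T] (S T) := (hM.asset_adapted T).measurable
  exact ((hM.stronglyMeasurable_discount ht le_rfl).measurable.mul
    ((h2.sub (h1.const_mul α)).max measurable_const)).stronglyMeasurable

theorem IsMarket.forwardPayoff_rightCts (hM : IsMarket Q 𝓕 D S T) (t : ℝ≥0) (ω : Ω) (u : ℝ≥0) :
    ContinuousWithinAt (fun v => forwardPayoff D S T α t v ω) (Ici u) u :=
  continuousWithinAt_const.mul
    ((continuousWithinAt_const.sub (continuousWithinAt_const.mul
      (hM.asset_rightCts ω u))).max continuousWithinAt_const)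

theorem IsMarket.integrable_forwardPayoff (hM : IsMarket Q 𝓕 D S T) (hα : 0 ≤ α) {t u : ℝ≥0}
    (ht : t ≤ T) (hu : u ≤ T) : Integrable (forwardPayoff D S T α t u) Q :=
  (hM.integrable t T ht le_rfl).mono'
    ((hM.stronglyMeasurable_forwardPayoff ht hu).mono (𝓕.le T)).aestronglyMeasurable
    (ae_of_all _ fun ω => by
      rw [Real.norm_of_nonneg (hM.forwardPayoff_nonneg t u ω)]
      exact hM.forwardPayoff_le hα t u ω)

/-- The test functions of the disintegration must be measurable for `𝓕 T` in the first variable,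
which is why time is stopped at `T`. -/
theorem IsMarket.measurable_uncurry_forwardPayoff (hM : IsMarket Q 𝓕 D S T) {t : ℝ≥0}
    (ht : t ≤ T) : Measurable[(𝓕 T).prod inferInstance]
      fun p : Ω × ℝ≥0 => forwardPayoff D S T α t (min p.2 T) p.1 :=
  @measurable_uncurry_of_rightCts Ω (𝓕 T) _ T
    (fun _ hu => (hM.stronglyMeasurable_forwardPayoff ht hu).measurable)
    (fun ω u _ => hM.forwardPayoff_rightCts t ω u)

theorem IsMarket.asset_integrable (hM : IsMarket Q 𝓕 D S T) {t : ℝ≥0} (ht : t ≤ T) :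
    Integrable (S t) Q := by
  refine (hM.integrable t t le_rfl ht).congr (ae_of_all _ fun ω => ?_)
  simp [discount, (hM.discount_pos t ω).ne']

theorem IsMarket.condExp_discounted_asset (hM : IsMarket Q 𝓕 D S T) {t : ℝ≥0} (ht : t ≤ T) :
    Q[fun ω => discount D t T ω * S T ω | 𝓕 t] =ᵐ[Q] S t := by
  refine (hM.martingale t t T le_rfl ht le_rfl).trans (ae_of_all _ fun ω => ?_)
  simp [discount, (hM.discount_pos t ω).ne']

/-- Joint measurability is available up to each finite horizon `n`, and stopping `ρ ω` at `n` is
eventually inactive. -/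
theorem IsMarket.measurable_sampled_asset (hM : IsMarket Q 𝓕 D S T) {ρ : Ω → ℝ≥0}
    (hρ : Measurable ρ) : Measurable fun ω => S (ρ ω) ω := by
  refine measurable_of_tendsto_metrizable (f := fun (n : ℕ) ω => S (min (ρ ω) n) ω)
    (fun n => ?_) (tendsto_pi_nhds.2 fun ω => ?_)
  · exact (measurable_uncurry_of_rightCts (T := n)
      (fun u _ => ((hM.asset_adapted u).mono (𝓕.le u)).measurable)
      (fun ω u _ => hM.asset_rightCts ω u)).comp (measurable_id.prodMk hρ)
  · refine tendsto_const_nhds.congr' ?_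
    obtain ⟨N, hN⟩ := exists_nat_ge (ρ ω)
    filter_upwards [eventually_ge_atTop N] with n hn
    rw [min_eq_left (hN.trans (by exact_mod_cast hn))]

/-- The payoff of the call struck at a random time is integrable. -/
theorem IsMarket.integrable_random_strike (hM : IsMarket Q 𝓕 D S T) (hα : 0 ≤ α) {t : ℝ≥0}
    (ht : t ≤ T) {ρ : Ω → ℝ≥0} (hρ : Measurable ρ) :
    Integrable (fun ω => forwardPayoff D S T α t (ρ ω) ω) Q := by
  have h1 : Measurable fun ω => forwardPayoff D S T α t (ρ ω) ω :=
    ((hM.stronglyMeasurable_discount ht le_rfl).mono (𝓕.le T)).measurable.mul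
      ((((hM.asset_adapted T).mono (𝓕.le T)).measurable.sub
        ((hM.measurable_sampled_asset hρ).const_mul α)).max measurable_const)
  refine (hM.integrable t T ht le_rfl).mono' h1.aestronglyMeasurable (ae_of_all _ fun ω => ?_)
  rw [Real.norm_of_nonneg (hM.forwardPayoff_nonneg _ _ ω)]
  exact hM.forwardPayoff_le hα _ _ ω

/-- As `B(t,T) = B(t,u) B(u,T)` with `B(t,u)` measurable for `𝓕 u`, projecting the payoff at `u`
gives `B(t,u) c(u,u,T)`. The payoff is at most `B(t,T) S_T`, which closes the martingale `B(t,u)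
S_u`. -/
theorem IsMarket.isProjection_forward (hM : IsMarket Q 𝓕 D S T) (hα : 0 ≤ α)
    {c : ℝ≥0 → ℝ≥0 → Ω → ℝ} (hc : IsForwardStartPrice Q 𝓕 D S T α c) {t : ℝ≥0} (ht : t ≤ T) :
    IsProjection Q 𝓕 t T (fun ω => discount D t T ω * S T ω) (forwardPayoff D S T α t)
      (fun u ω => discount D t u ω * c u u ω) (fun u ω => discount D t u ω * S u ω) where
  integrable := hM.integrable t T ht le_rfl
  measurable u hu := ((hM.stronglyMeasurable_forwardPayoff ht hu.2).mono (𝓕.le T)).measurable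
  nonneg u ω := hM.forwardPayoff_nonneg t u ω
  le u ω := hM.forwardPayoff_le hα t u ω
  rightCts ω u _ := hM.forwardPayoff_rightCts t ω u
  martingale_meas u hu := (hM.stronglyMeasurable_discount hu.1 le_rfl).mul (hM.asset_adapted u)
  martingale_nonneg u ω := mul_nonneg (hM.discount_pos' t u ω).le (hM.asset_nonneg u ω)
  martingale_rightCts ω u _ :=
    ((hM.discount_rightCts ω u).div_const _).mul (hM.asset_rightCts ω u)
  martingale_version u hu := (hM.martingale t u T hu.1 hu.2 le_rfl).symm
  version u hu := by
    have e : discount D t u * forwardPayoff D S T α u u = forwardPayoff D S T α t u := by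
      ext ω
      have h1 := (hM.discount_pos t ω).ne'
      have h2 := (hM.discount_pos u ω).ne'
      simp only [Pi.mul_apply, forwardPayoff, discount]
      field_simp
    have h1 : Q[discount D t u * forwardPayoff D S T α u u | 𝓕 u]
        =ᵐ[Q] discount D t u * Q[forwardPayoff D S T α u u | 𝓕 u] :=
      condExp_mul_of_stronglyMeasurable_left (hM.stronglyMeasurable_discount hu.1 le_rfl)
        (by rw [e]; exact hM.integrable_forwardPayoff hα ht hu.2)
        (hM.integrable_forwardPayoff hα hu.2 hu.2)
    rw [e] at h1
    exact (EventuallyEq.rfl.mul (hc.version u u le_rfl hu.2)).trans h1.symm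
  proj_rightCts := by
    filter_upwards [hc.rightCts] with ω hω u hu
    exact ((hM.discount_rightCts ω u).div_const _).mul (hω u hu)

/-- Risk neutrality says that the projection of the constant process `B(t,T) S_T` is the discounted
asset, so `Y` and `M` coincide. -/
theorem IsMarket.isProjection_asset (hM : IsMarket Q 𝓕 D S T) {t : ℝ≥0} (ht : t ≤ T) :
    IsProjection Q 𝓕 t T (fun ω => discount D t T ω * S T ω)
      (fun _ ω => discount D t T ω * S T ω)
      (fun u ω => discount D t u ω * S u ω) (fun u ω => discount D t u ω * S u ω) where
  integrable := hM.integrable t T ht le_rfl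
  measurable _ _ := (((hM.stronglyMeasurable_discount ht le_rfl).mul
    (hM.asset_adapted T)).mono (𝓕.le T)).measurable
  nonneg _ ω := mul_nonneg (hM.discount_pos' t T ω).le (hM.asset_nonneg T ω)
  le _ _ := le_rfl
  rightCts _ _ _ := continuousWithinAt_const
  martingale_meas u hu := (hM.stronglyMeasurable_discount hu.1 le_rfl).mul (hM.asset_adapted u)
  martingale_nonneg u ω := mul_nonneg (hM.discount_pos' t u ω).le (hM.asset_nonneg u ω)
  martingale_rightCts ω u _ :=
    ((hM.discount_rightCts ω u).div_const _).mul (hM.asset_rightCts ω u)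
  martingale_version u hu := (hM.martingale t u T hu.1 hu.2 le_rfl).symm
  version u hu := (hM.martingale t u T hu.1 hu.2 le_rfl).symm
  proj_rightCts := ae_of_all _ fun ω u _ =>
    ((hM.discount_rightCts ω u).div_const _).mul (hM.asset_rightCts ω u)

end Market

/-! ### Consequences of the disintegration -/

namespace IsHazardKernel

variable {Q : Measure Ω} [IsProbabilityMeasure Q] {𝓕 : Filtration ℝ≥0 m} {τ : Ω → ℝ≥0∞}
  {T t : ℝ≥0} {F : ℝ≥0 → Ω → ℝ} {κ : Kernel Ω ℝ≥0}

theorem aestronglyMeasurable_distribution (hF : IsCondDistribution Q 𝓕 τ T F) {u : ℝ≥0}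
    (hu : u ≤ T) : AEStronglyMeasurable[𝓕 u] (F u) Q :=
  ⟨_, stronglyMeasurable_condExp, hF.version u hu⟩

theorem ae_Ioc (h : IsHazardKernel Q 𝓕 τ T F κ) :
    ∀ᵐ ω ∂Q, ∀ a b, a ≤ b → b ≤ T → (κ ω).real (Ioc a b) = F b ω - F a ω := by
  have := h.markov
  filter_upwards [h.distribution] with ω hω a b hab hb
  rw [hω b hb, hω a (hab.trans hb), ← Iic_sdiff_Iic,
    measureReal_sdiff (Iic_subset_Iic.2 hab) measurableSet_Iic]

/-- Almost surely the mass is `F b - F a`. This is the adaptedness required to project under `κ`. -/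
theorem adapted (h : IsHazardKernel Q 𝓕 τ T F κ) (hF : IsCondDistribution Q 𝓕 τ T F) (a b : ℝ≥0)
    (hb : b ≤ T) : AEStronglyMeasurable[𝓕 b] (fun ω => (κ ω).real (Ioc a b)) Q := by
  rcases lt_or_ge b a with hab | hab
  · simp only [Ioc_eq_empty (not_lt.2 hab.le), measureReal_empty]
    exact aestronglyMeasurable_const
  · refine ((aestronglyMeasurable_distribution hF hb).sub
      ((aestronglyMeasurable_distribution hF (hab.trans hb)).mono (𝓕.mono hab))).congr ?_
    filter_upwards [h.ae_Ioc] with ω hω using (hω a b hab hb).symm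

theorem ae_mem_Ico (h : IsHazardKernel Q 𝓕 τ T F κ) (hF : IsCondDistribution Q 𝓕 τ T F) :
    ∀ᵐ ω ∂Q, ∀ u ≤ T, F u ω ∈ Ico (0 : ℝ) 1 := by
  filter_upwards [h.distribution, hF.lt_one] with ω h1 h2 u hu
  exact ⟨by rw [h1 u hu]; exact measureReal_nonneg, h2 u hu⟩

theorem ae_hazardIntegral (h : IsHazardKernel Q 𝓕 τ T F κ) (hF : IsCondDistribution Q 𝓕 τ T F)
    (ht : t ≤ T) : ∀ᵐ ω ∂Q, ∀ X : ℝ≥0 → Ω → ℝ,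
      hazardIntegral F X t T ω = (1 - F t ω)⁻¹ * ∫ u in Ioc t T, X u ω ∂κ ω := by
  have := h.markov
  filter_upwards [h.distribution, hF.continuous, hF.lt_one] with ω h1 h2 h3 X
  exact integral_stieltjes h1 h2 h3 ht fun u => X u ω

theorem hazardIntegrable (h : IsHazardKernel Q 𝓕 τ T F κ) (hF : IsCondDistribution Q 𝓕 τ T F)
    (ht : t ≤ T) {X : ℝ≥0 → Ω → ℝ} (hX : ∀ᵐ ω ∂Q, IntegrableOn (fun u => X u ω) (Ioc t T) (κ ω)) :
    HazardIntegrable Q F X t T := by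
  have := h.markov
  filter_upwards [h.distribution, hF.continuous, hF.lt_one, hX] with ω h1 h2 h3 h4
  exact integrableOn_stieltjes h1 h2 h3 ht h4

theorem integrable_distribution (hF : IsCondDistribution Q 𝓕 τ T F) {u : ℝ≥0}
    (hu : u ≤ T) : Integrable (F u) Q := integrable_condExp.congr (hF.version u hu).symm

/-- The gain over the definition of `F` is the conditioning on `𝓕 T` in place of `𝓕 u`, which the
disintegration over `𝓕 T` provides. -/
theorem condExp_survival (h : IsHazardKernel Q 𝓕 τ T F κ) (hF : IsCondDistribution Q 𝓕 τ T F)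
    (hτ : Measurable τ) {u : ℝ≥0} (hu : u ≤ T) :
    (fun ω => 1 - F u ω) =ᵐ[Q] Q[{ω | (u : ℝ≥0∞) < τ ω}.indicator (1 : Ω → ℝ) | 𝓕 T] := by
  have := h.markov
  have hE : MeasurableSet {ω | (u : ℝ≥0∞) < τ ω} := measurableSet_lt measurable_const hτ
  have hFi := integrable_distribution hF hu
  refine ae_eq_condExp_of_forall_setIntegral_eq (𝓕.le T)
    ((integrable_const (1 : ℝ)).indicator hE)
    (fun s _ _ => ((integrable_const _).sub hFi).integrableOn) (fun A hA _ => ?_)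
    (aestronglyMeasurable_const.sub
      ((aestronglyMeasurable_distribution hF hu).mono (𝓕.mono hu)))
  have hA' : MeasurableSet A := 𝓕.le T _ hA
  have h1 : ∫ ω in A, F u ω ∂Q = Q.real (A ∩ {ω | τ ω ≤ u}) := by
    rw [← setIntegral_measureReal_Iic hτ κ h.disintegration hu hA]
    exact setIntegral_congr_ae hA' (h.distribution.mono fun ω hω _ => hω u hu)
  have h2 : A ∩ {ω | τ ω ≤ u} = A \ (A ∩ {ω | (u : ℝ≥0∞) < τ ω}) := by
    ext ω
    simp only [mem_inter_iff, mem_ofPred_eq, Set.mem_sdiff, not_and, not_lt]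
    tauto
  rw [integral_sub (integrable_const _) hFi.integrableOn, h1, h2,
    measureReal_sdiff inter_subset_left (hA'.inter hE), setIntegral_indicator hE]
  simp [Measure.real]

/-- Before maturity, an `𝓕 T`-measurable variable only feels the survival probability. -/
theorem setIntegral_survival (h : IsHazardKernel Q 𝓕 τ T F κ) (hF : IsCondDistribution Q 𝓕 τ T F)
    (hτ : Measurable τ) {u : ℝ≥0} (hu : u ≤ T) {V : Ω → ℝ} (hV : Integrable V Q)
    (hVm : AEStronglyMeasurable[𝓕 T] V Q) {A : Set Ω} (hA : MeasurableSet[𝓕 T] A) :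
    ∫ ω in A ∩ {ω | (u : ℝ≥0∞) < τ ω}, V ω ∂Q = ∫ ω in A, (1 - F u ω) * V ω ∂Q := by
  have hE : MeasurableSet {ω | (u : ℝ≥0∞) < τ ω} := measurableSet_lt measurable_const hτ
  have hEi : Integrable ({ω | (u : ℝ≥0∞) < τ ω}.indicator (1 : Ω → ℝ)) Q :=
    (integrable_const (1 : ℝ)).indicator hE
  have hi : Integrable ({ω | (u : ℝ≥0∞) < τ ω}.indicator (1 : Ω → ℝ) * V) Q := by
    refine (hV.indicator hE).congr (ae_of_all _ fun ω => ?_)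
    by_cases h : (u : ℝ≥0∞) < τ ω <;> simp [h]
  have h1 : Q[{ω | (u : ℝ≥0∞) < τ ω}.indicator (1 : Ω → ℝ) * V | 𝓕 T]
      =ᵐ[Q] fun ω => (1 - F u ω) * V ω := by
    refine (condExp_mul_of_aestronglyMeasurable_right hVm hi hEi).trans ?_
    filter_upwards [h.condExp_survival hF hτ hu] with ω hω
    rw [Pi.mul_apply, ← hω]
  have hA' : MeasurableSet A := 𝓕.le T _ hA
  calc ∫ ω in A ∩ {ω | (u : ℝ≥0∞) < τ ω}, V ω ∂Q
      = ∫ ω in A, ({ω | (u : ℝ≥0∞) < τ ω}.indicator (1 : Ω → ℝ) * V) ω ∂Q := by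
        rw [← setIntegral_indicator hE]
        refine integral_congr_ae (ae_of_all _ fun ω => ?_)
        by_cases h : (u : ℝ≥0∞) < τ ω <;> simp [h]
    _ = ∫ ω in A, (Q[{ω | (u : ℝ≥0∞) < τ ω}.indicator (1 : Ω → ℝ) * V | 𝓕 T]) ω ∂Q :=
        (setIntegral_condExp (𝓕.le T) hi hA).symm
    _ = _ := setIntegral_congr_ae hA' (h1.mono fun ω hω _ => hω)

theorem integrable_survival_mul (h : IsHazardKernel Q 𝓕 τ T F κ)
    (hF : IsCondDistribution Q 𝓕 τ T F) {u : ℝ≥0} (hu : u ≤ T) {V : Ω → ℝ} (hV : Integrable V Q) :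
    Integrable (fun ω => (1 - F u ω) * V ω) Q := by
  refine hV.bdd_mul (c := 1) (aestronglyMeasurable_const.sub
    (integrable_distribution hF hu).aestronglyMeasurable) ?_
  filter_upwards [h.ae_mem_Ico hF] with ω hω
  have := hω u hu
  rw [Real.norm_of_nonneg (by linarith [this.2])]
  linarith [this.1]

/-- The survival factor `1 - F_t` is `𝓕 t`-measurable, so once it has replaced the event `{τ > t}`
the conditional expectation can be dropped. -/
theorem setIntegral_survival_condExp (h : IsHazardKernel Q 𝓕 τ T F κ)
    (hF : IsCondDistribution Q 𝓕 τ T F) (hτ : Measurable τ) (ht : t ≤ T) {V : Ω → ℝ}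
    (hV : Integrable V Q) {A : Set Ω} (hA : MeasurableSet[𝓕 t] A) :
    ∫ ω in A ∩ {ω | (t : ℝ≥0∞) < τ ω}, (Q[V | 𝓕 t]) ω ∂Q = ∫ ω in A, (1 - F t ω) * V ω ∂Q := by
  rw [h.setIntegral_survival hF hτ ht integrable_condExp
    (stronglyMeasurable_condExp.mono (𝓕.mono ht)).aestronglyMeasurable (𝓕.mono ht _ hA)]
  have hi := h.integrable_survival_mul hF ht hV
  have h1 : Q[fun ω => (1 - F t ω) * V ω | 𝓕 t] =ᵐ[Q] fun ω => (1 - F t ω) * (Q[V | 𝓕 t]) ω :=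
    condExp_mul_of_aestronglyMeasurable_left
      (aestronglyMeasurable_const.sub (aestronglyMeasurable_distribution hF ht)) hi hV
  rw [← setIntegral_condExp (𝓕.le t) hi hA]
  exact setIntegral_congr_ae (𝓕.le t _ hA) (h1.mono fun ω hω _ => hω.symm)

/-- The law of a process sampled at the random time. -/
theorem lintegral_sampled (h : IsHazardKernel Q 𝓕 τ T F κ) (hτ : Measurable τ) (ht : t ≤ T)
    {X : ℝ≥0 → Ω → ℝ}
    (hX : Measurable[(𝓕 T).prod inferInstance] fun p : Ω × ℝ≥0 => X (min p.2 T) p.1)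
    {A : Set Ω} (hA : MeasurableSet[𝓕 T] A) :
    ∫⁻ ω in A ∩ {ω | (t : ℝ≥0∞) < τ ω ∧ τ ω ≤ T}, ENNReal.ofReal (X (cappedTime τ T ω) ω) ∂Q
      = ∫⁻ ω, ∫⁻ u in Ioc t T, ENNReal.ofReal (X u ω * A.indicator 1 ω) ∂κ ω ∂Q := by
  have hs : MeasurableSet {ω | (t : ℝ≥0∞) < τ ω ∧ τ ω ≤ T} :=
    (measurableSet_lt measurable_const hτ).inter (measurableSet_le hτ measurable_const)
  have hA' : MeasurableSet A := 𝓕.le T _ hA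
  -- Stopping at `T` makes the test function jointly measurable and changes nothing on `(t,T]`.
  have hm : Measurable[(𝓕 T).prod inferInstance] ((A ×ˢ Ioc t T).indicator
      fun p : Ω × ℝ≥0 => ENNReal.ofReal (X (min p.2 T) p.1)) :=
    (@Measurable.ennreal_ofReal _ ((𝓕 T).prod inferInstance) _ hX).indicator
      (@MeasurableSet.prod _ _ (𝓕 T) _ _ _ hA measurableSet_Ioc)
  have key := h.disintegration _ hm
  rw [← lintegral_indicator (hA'.inter hs)]
  refine Eq.trans (lintegral_congr fun ω => ?_) (key.trans (lintegral_congr fun ω => ?_))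
  · have h1 := cappedTime_mem_Ioc ht (τ := τ) ω
    by_cases h2 : ω ∈ A ∧ cappedTime τ T ω ∈ Ioc t T
    · rw [indicator_of_mem (show ω ∈ A ∩ {ω | (t : ℝ≥0∞) < τ ω ∧ τ ω ≤ T} from
        ⟨h2.1, h1.1 h2.2⟩), indicator_of_mem (show (ω, cappedTime τ T ω) ∈ A ×ˢ Ioc t T from h2),
        min_eq_left h2.2.2]
    · rw [indicator_of_notMem (fun h3 => h2 ⟨h3.1, h1.2 h3.2⟩),
        indicator_of_notMem (show (ω, cappedTime τ T ω) ∉ A ×ˢ Ioc t T from h2)]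
  · rw [← lintegral_indicator measurableSet_Ioc]
    refine lintegral_congr fun u => ?_
    by_cases h1 : ω ∈ A <;> by_cases h2 : u ∈ Ioc t T
    · rw [indicator_of_mem (show (ω, u) ∈ A ×ˢ Ioc t T from ⟨h1, h2⟩), indicator_of_mem h2,
        min_eq_left h2.2, indicator_of_mem h1, Pi.one_apply, mul_one]
    · rw [indicator_of_notMem (fun h3 => h2 h3.2), indicator_of_notMem h2]
    · rw [indicator_of_notMem (fun h3 => h1 h3.1), indicator_of_mem h2, indicator_of_notMem h1,
        mul_zero, ENNReal.ofReal_zero]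
    · rw [indicator_of_notMem (fun h3 => h2 h3.2), indicator_of_notMem h2]

end IsHazardKernel

end

noncomputable section

variable {Ω : Type*} [m : MeasurableSpace Ω]

/-! ### Valuation -/

section Valuation

variable {Q : Measure Ω} [IsProbabilityMeasure Q] {𝓕 : Filtration ℝ≥0 m} {D S : ℝ≥0 → Ω → ℝ}
  {T t : ℝ≥0} {α : ℝ} {τ : Ω → ℝ≥0∞} {F : ℝ≥0 → Ω → ℝ} {κ : Kernel Ω ℝ≥0}

theorem IsMarket.integrable_payoff (hM : IsMarket Q 𝓕 D S T) (hα : 0 ≤ α) (hτ : Measurable τ)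
    (ht : t ≤ T) : Integrable (payoff D S T α τ t) Q :=
  hM.integrable_random_strike hα ht (hτ.min measurable_const).ennreal_toNNReal

theorem IsMarket.integrable_struckPayoff (hM : IsMarket Q 𝓕 D S T) (hα : 0 ≤ α)
    (hτ : Measurable τ) (ht : t ≤ T) : Integrable (struckPayoff D S T α τ t) Q :=
  hM.integrable_random_strike hα ht hτ.ennreal_toNNReal

/-- The price splits into the already struck part and the part before the random time. -/
theorem IsMarket.price_eq (hM : IsMarket Q 𝓕 D S T) (hα : 0 ≤ α) (hτ : Measurable τ)
    (hτ_pos : ∀ᵐ ω ∂Q, 0 < τ ω) (ht : t ≤ T) {Z : Ω → ℝ}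
    (hZ : {ω | (t : ℝ≥0∞) < τ ω}.indicator (price Q 𝓕 D S T α τ hτ t)
      =ᵐ[Q] {ω | (t : ℝ≥0∞) < τ ω}.indicator Z) :
    price Q 𝓕 D S T α τ hτ t =ᵐ[Q] fun ω =>
      struckTerm Q 𝓕 D S T α τ hτ t ω + {ω | (t : ℝ≥0∞) < τ ω}.indicator Z ω := by
  have hB := measurableSet_enlarged_le 𝓕 hτ t
  have h1 : {ω | τ ω ≤ t}.indicator (payoff D S T α τ t)
      = {ω | τ ω ≤ t}.indicator (struckPayoff D S T α τ t) := by
    ext ω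
    by_cases h : τ ω ≤ t
    · have h' : τ ω ≤ T := h.trans (by exact_mod_cast ht)
      simp [h, payoff, struckPayoff, h']
    · simp [h]
  have h2 := condExp_indicator (hM.integrable_payoff hα hτ ht) hB
  have h3 := condExp_indicator (hM.integrable_struckPayoff hα hτ ht) hB
  rw [h1] at h2
  filter_upwards [h2.symm.trans h3, hZ, hτ_pos] with ω a b c
  by_cases h : τ ω ≤ t
  · have h' : ¬ (t : ℝ≥0∞) < τ ω := not_lt.2 h
    simpa [struckTerm, price, h, h', c] using a
  · have h' : (t : ℝ≥0∞) < τ ω := not_le.1 h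
    simpa [struckTerm, h, h'] using b

/-- The event is split at `T`. On `{τ > T}` the strike is set at `T`, and `α ≤ 1` makes the positive
part equal to `(1 - α) S_T`. -/
theorem IsHazardKernel.setIntegral_payoff (h : IsHazardKernel Q 𝓕 τ T F κ)
    (hF : IsCondDistribution Q 𝓕 τ T F) (hM : IsMarket Q 𝓕 D S T) (hα : α ∈ Icc (0 : ℝ) 1)
    (hτ : Measurable τ) (ht : t ≤ T) {A : Set Ω} (hA : MeasurableSet[𝓕 T] A) :
    ∫ ω in A ∩ {ω | (t : ℝ≥0∞) < τ ω}, payoff D S T α τ t ω ∂Q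
      = ∫ ω in A ∩ {ω | (t : ℝ≥0∞) < τ ω ∧ τ ω ≤ T},
          forwardPayoff D S T α t (cappedTime τ T ω) ω ∂Q
        + (1 - α) * ∫ ω in A, (1 - F T ω) * (discount D t T ω * S T ω) ∂Q := by
  have hA' : MeasurableSet A := 𝓕.le T _ hA
  have hs : MeasurableSet {ω | (t : ℝ≥0∞) < τ ω ∧ τ ω ≤ T} :=
    (measurableSet_lt measurable_const hτ).inter (measurableSet_le hτ measurable_const)
  have hs' : MeasurableSet {ω | (T : ℝ≥0∞) < τ ω} := measurableSet_lt measurable_const hτ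
  have htT : (t : ℝ≥0∞) ≤ T := by exact_mod_cast ht
  have e : A ∩ {ω | (t : ℝ≥0∞) < τ ω} = (A ∩ {ω | (t : ℝ≥0∞) < τ ω ∧ τ ω ≤ T})
      ∪ (A ∩ {ω | (T : ℝ≥0∞) < τ ω}) := by
    ext ω
    simp only [mem_inter_iff, mem_ofPred_eq, mem_union]
    constructor
    · rintro ⟨h1, h2⟩
      rcases le_or_gt (τ ω) T with h3 | h3
      · exact Or.inl ⟨h1, h2, h3⟩
      · exact Or.inr ⟨h1, h3⟩
    · rintro (⟨h1, h2, -⟩ | ⟨h1, h2⟩)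
      · exact ⟨h1, h2⟩
      · exact ⟨h1, htT.trans_lt h2⟩
  have hd : Disjoint (A ∩ {ω | (t : ℝ≥0∞) < τ ω ∧ τ ω ≤ T}) (A ∩ {ω | (T : ℝ≥0∞) < τ ω}) := by
    rw [Set.disjoint_left]
    rintro ω ⟨-, -, h1⟩ ⟨-, h2⟩
    exact absurd h1 (not_le.2 h2)
  have hP := hM.integrable_payoff hα.1 hτ ht
  rw [e, setIntegral_union hd (hA'.inter hs') hP.integrableOn hP.integrableOn]
  congr 1
  · refine setIntegral_congr_fun (hA'.inter hs) fun ω hω => ?_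
    have h1 : τ ω ≤ T := hω.2.2
    simp only [payoff, forwardPayoff, cappedTime_eq h1, min_eq_left h1]
  · have hξm : StronglyMeasurable[𝓕 T] fun ω => discount D t T ω * S T ω :=
      (hM.stronglyMeasurable_discount ht le_rfl).mul (hM.asset_adapted T)
    rw [← h.setIntegral_survival hF hτ le_rfl (hM.integrable t T ht le_rfl)
      hξm.aestronglyMeasurable hA, ← integral_const_mul]
    refine setIntegral_congr_fun (hA'.inter hs') fun ω hω => ?_
    have h1 : (T : ℝ≥0∞) ≤ τ ω := (show (T : ℝ≥0∞) < τ ω from hω.2).le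
    have h2 : 0 ≤ S T ω - α * S T ω := by
      have := mul_le_mul_of_nonneg_right hα.2 (hM.asset_nonneg T ω)
      linarith
    simp only [payoff, min_eq_right h1, ENNReal.toNNReal_coe, max_eq_left h2]
    ring

/-- The payoff struck at the random time, in terms of the projected prices. -/
theorem IsHazardKernel.setIntegral_struck (h : IsHazardKernel Q 𝓕 τ T F κ)
    (hF : IsCondDistribution Q 𝓕 τ T F) (hM : IsMarket Q 𝓕 D S T) (hα : 0 ≤ α)
    (hτ : Measurable τ) (ht : t ≤ T) {ξ : Ω → ℝ} {Y M : ℝ≥0 → Ω → ℝ}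
    (hY : IsProjection Q 𝓕 t T ξ (forwardPayoff D S T α t) Y M) {A : Set Ω}
    (hA : MeasurableSet[𝓕 t] A) :
    ∫ ω in A ∩ {ω | (t : ℝ≥0∞) < τ ω ∧ τ ω ≤ T},
        forwardPayoff D S T α t (cappedTime τ T ω) ω ∂Q
      = ∫ ω in A, ∫ u in Ioc t T, Y u ω ∂κ ω ∂Q := by
  have := h.markov
  have hA' : MeasurableSet A := 𝓕.le t _ hA
  have h1 := h.lintegral_sampled hτ ht (hM.measurable_uncurry_forwardPayoff (α := α) ht)
    (𝓕.mono ht _ hA)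
  -- Here the weight is `1_A`, which is `𝓕 t`-measurable and bounded by `1`.
  have h2 := (hY.integrable_proj (h.adapted hF) (w := A.indicator 1)
    (stronglyMeasurable_one.indicator hA).aestronglyMeasurable
    (fun ω => indicator_nonneg (by simp) ω) (C := 1)
    (ae_of_all _ fun ω => by
      refine mul_le_one₀ (indicator_le_self' (f := (1 : Ω → ℝ)) (by simp) ω)
        measureReal_nonneg measureReal_le_one)).2
  have h3 : ∀ ω, A.indicator (1 : Ω → ℝ) ω * ∫ u in Ioc t T, Y u ω ∂κ ω
      = A.indicator (fun ω => ∫ u in Ioc t T, Y u ω ∂κ ω) ω := fun ω => by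
    by_cases hω : ω ∈ A <;> simp [hω]
  simp only [h3] at h2
  rw [integral_indicator hA', ← h1, ← ofReal_integral_eq_lintegral_ofReal
    (hM.integrable_random_strike hα ht (measurable_cappedTime hτ T)).integrableOn
    (ae_of_all _ fun ω => hM.forwardPayoff_nonneg _ _ ω)] at h2
  refine ((ENNReal.ofReal_eq_ofReal_iff ?_ ?_).1 h2).symm
  · exact integral_nonneg_of_ae (ae_restrict_of_ae hY.integral_proj_nonneg)
  · exact integral_nonneg fun ω => hM.forwardPayoff_nonneg _ _ ω

/-- The constant process `ξ` integrates to `ξ` times the mass `F_T - F_t` of `(t,T]`; then it is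
replaced by its projection. -/
theorem IsHazardKernel.setIntegral_asset (h : IsHazardKernel Q 𝓕 τ T F κ)
    (hF : IsCondDistribution Q 𝓕 τ T F) (ht : t ≤ T) {ξ : Ω → ℝ} {Y M : ℝ≥0 → Ω → ℝ}
    (hY : IsProjection Q 𝓕 t T ξ (fun _ => ξ) Y M) {A : Set Ω} (hA : MeasurableSet[𝓕 t] A) :
    ∫ ω in A, (F T ω - F t ω) * ξ ω ∂Q = ∫ ω in A, ∫ u in Ioc t T, Y u ω ∂κ ω ∂Q := by
  have := h.markov
  have hA' : MeasurableSet A := 𝓕.le t _ hA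
  have hξ0 : ∀ ω, 0 ≤ ξ ω := hY.nonneg 0
  have h2 := (hY.integrable_proj (h.adapted hF) (w := A.indicator 1)
    (stronglyMeasurable_one.indicator hA).aestronglyMeasurable
    (fun ω => indicator_nonneg (by simp) ω) (C := 1)
    (ae_of_all _ fun ω => by
      refine mul_le_one₀ (indicator_le_self' (f := (1 : Ω → ℝ)) (by simp) ω)
        measureReal_nonneg measureReal_le_one)).2
  have h3 : ∀ ω, A.indicator (1 : Ω → ℝ) ω * ∫ u in Ioc t T, Y u ω ∂κ ω
      = A.indicator (fun ω => ∫ u in Ioc t T, Y u ω ∂κ ω) ω := fun ω => by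
    by_cases hω : ω ∈ A <;> simp [hω]
  have hnn : ∀ᵐ ω ∂Q, 0 ≤ (F T ω - F t ω) * ξ ω := by
    filter_upwards [h.ae_Ioc] with ω hω
    rw [← hω t T ht le_rfl]
    exact mul_nonneg measureReal_nonneg (hξ0 ω)
  have hi : Integrable (fun ω => (F T ω - F t ω) * ξ ω) Q := by
    refine ((h.integrable_survival_mul hF ht hY.integrable).sub
      (h.integrable_survival_mul hF le_rfl hY.integrable)).congr (ae_of_all _ fun ω => ?_)
    simp only [Pi.sub_apply]
    ring
  have h4 : ∫⁻ ω, ∫⁻ _ in Ioc t T, ENNReal.ofReal (ξ ω * A.indicator 1 ω) ∂κ ω ∂Q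
      = ∫⁻ ω in A, ENNReal.ofReal ((F T ω - F t ω) * ξ ω) ∂Q := by
    rw [← lintegral_indicator hA']
    refine lintegral_congr_ae ?_
    filter_upwards [h.ae_Ioc] with ω hω
    rw [lintegral_const, Measure.restrict_apply_univ]
    by_cases hωA : ω ∈ A
    · rw [indicator_of_mem hωA, indicator_of_mem hωA, Pi.one_apply, mul_one, mul_comm (_ - _),
        ← hω t T ht le_rfl, ENNReal.ofReal_mul (hξ0 ω), ofReal_measureReal]
    · simp [hωA]
  simp only [h3] at h2
  rw [integral_indicator hA', h4, ← ofReal_integral_eq_lintegral_ofReal hi.integrableOn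
    (ae_restrict_of_ae hnn)] at h2
  refine ((ENNReal.ofReal_eq_ofReal_iff ?_ ?_).1 h2).symm
  · exact integral_nonneg_of_ae (ae_restrict_of_ae hY.integral_proj_nonneg)
  · exact integral_nonneg_of_ae (ae_restrict_of_ae hnn)

/-- The weight `(1 - F_t)⁻¹` is unbounded, but its product with the mass `F_T - F_t` is at most `1`.
-/
theorem IsHazardKernel.integrable_hazardIntegral (h : IsHazardKernel Q 𝓕 τ T F κ)
    (hF : IsCondDistribution Q 𝓕 τ T F) (ht : t ≤ T) {ξ : Ω → ℝ} {X Y M : ℝ≥0 → Ω → ℝ}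
    (hY : IsProjection Q 𝓕 t T ξ X Y M) : Integrable (hazardIntegral F Y t T) Q := by
  have := h.markov
  -- The absolute value makes the weight nonnegative everywhere; `F_t < 1` is known only almost
  -- surely.
  have hw : AEStronglyMeasurable[𝓕 t] (fun ω => |(1 - F t ω)⁻¹|) Q := by
    obtain ⟨g, hg, hgF⟩ := aestronglyMeasurable_distribution hF ht
    refine ⟨fun ω => |(1 - g ω)⁻¹|, ?_, hgF.mono fun ω hω => by simp only [hω]⟩
    have h1 : Measurable[𝓕 t] fun ω => (1 - g ω)⁻¹ := (measurable_const.sub hg.measurable).inv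
    exact (continuous_abs.measurable.comp h1).stronglyMeasurable
  refine (hY.integrable_proj (h.adapted hF) hw (fun ω => abs_nonneg _) (C := 1) ?_).1.congr ?_
  · filter_upwards [h.ae_Ioc, h.ae_mem_Ico hF] with ω h1 h2
    have h3 := h2 T le_rfl
    have h4 : 0 < 1 - F t ω := by linarith [(h2 t ht).2]
    rw [h1 t T ht le_rfl, abs_of_pos (inv_pos.2 h4), inv_mul_le_iff₀ h4]
    linarith [h3.2]
  · filter_upwards [h.ae_hazardIntegral hF ht, h.ae_mem_Ico hF] with ω h1 h2
    have h4 : 0 < 1 - F t ω := by linarith [(h2 t ht).2]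
    rw [h1, abs_of_pos (inv_pos.2 h4)]

theorem IsHazardKernel.survival_mul_hazardIntegral (h : IsHazardKernel Q 𝓕 τ T F κ)
    (hF : IsCondDistribution Q 𝓕 τ T F) (ht : t ≤ T) (Y : ℝ≥0 → Ω → ℝ) :
    ∀ᵐ ω ∂Q, (1 - F t ω) * hazardIntegral F Y t T ω = ∫ u in Ioc t T, Y u ω ∂κ ω := by
  filter_upwards [h.ae_hazardIntegral hF ht, h.ae_mem_Ico hF] with ω h1 h2
  have h4 : 0 < 1 - F t ω := by linarith [(h2 t ht).2]
  rw [h1, mul_inv_cancel_left₀ h4.ne']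

theorem price_of_hypothesisH {c : ℝ≥0 → ℝ≥0 → Ω → ℝ} (hM : IsMarket Q 𝓕 D S T)
    (hα : α ∈ Icc (0 : ℝ) 1) (hτ : Measurable τ) (hτ_pos : ∀ᵐ ω ∂Q, 0 < τ ω)
    (hc : IsForwardStartPrice Q 𝓕 D S T α c) (hF : IsCondDistribution Q 𝓕 τ T F) (ht : t ≤ T)
    (hH : HypothesisH Q 𝓕 τ hτ) :
    HazardIntegrable Q F (fun u ω => discount D t u ω * c u u ω) t T ∧
    HazardIntegrable Q F (fun u ω => discount D t u ω * S u ω) t T ∧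
    Integrable (hazardIntegral F (fun u ω => discount D t u ω * c u u ω) t T) Q ∧
    Integrable (hazardIntegral F (fun u ω => discount D t u ω * S u ω) t T) Q ∧
    price Q 𝓕 D S T α τ hτ t =ᵐ[Q] fun ω =>
      struckTerm Q 𝓕 D S T α τ hτ t ω
      + (1 - α) * {ω | (t : ℝ≥0∞) < τ ω}.indicator (S t) ω
      + {ω | (t : ℝ≥0∞) < τ ω}.indicator
          (Q[hazardIntegral F (fun u ω => discount D t u ω * c u u ω) t T | 𝓕 t]) ω
      - (1 - α) * {ω | (t : ℝ≥0∞) < τ ω}.indicator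
          (Q[hazardIntegral F (fun u ω => discount D t u ω * S u ω) t T | 𝓕 t]) ω := by
  obtain ⟨κ, h⟩ := hH.exists_kernel hF
  have := h.markov
  have hY := hM.isProjection_forward hα.1 hc ht
  have hX := hM.isProjection_asset ht
  have hYi := h.integrable_hazardIntegral hF ht hY
  have hXi := h.integrable_hazardIntegral hF ht hX
  have hξ := hM.integrable t T ht le_rfl
  refine ⟨h.hazardIntegrable hF ht (hY.integrableOn_proj_path (h.adapted hF)),
    h.hazardIntegrable hF ht (hX.integrableOn_proj_path (h.adapted hF)), hYi, hXi, ?_⟩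
  set HY := hazardIntegral F (fun u ω => discount D t u ω * c u u ω) t T with hHY
  set HX := hazardIntegral F (fun u ω => discount D t u ω * S u ω) t T with hHX
  set ξ : Ω → ℝ := fun ω => discount D t T ω * S T ω with hξdef
  -- `S_t` enters as `E[ξ | 𝓕 t]`, so all three terms are handled by `setIntegral_survival_condExp`.
  let Z : Ω → ℝ := fun ω => (1 - α) * (Q[ξ | 𝓕 t]) ω + (Q[HY | 𝓕 t]) ω
    - (1 - α) * (Q[HX | 𝓕 t]) ω
  have hZ1 : Integrable (fun ω => (1 - α) * (Q[ξ | 𝓕 t]) ω) Q := integrable_condExp.const_mul _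
  have hZ3 : Integrable (fun ω => (1 - α) * (Q[HX | 𝓕 t]) ω) Q := integrable_condExp.const_mul _
  have hZ12 : Integrable (fun ω => (1 - α) * (Q[ξ | 𝓕 t]) ω + (Q[HY | 𝓕 t]) ω) Q :=
    hZ1.add integrable_condExp
  have hZi : Integrable Z Q := hZ12.sub hZ3
  have hZm : StronglyMeasurable[𝓕 t] Z :=
    ((stronglyMeasurable_condExp.const_mul _).add stronglyMeasurable_condExp).sub
      (stronglyMeasurable_condExp.const_mul _)
  have key : {ω | (t : ℝ≥0∞) < τ ω}.indicator (price Q 𝓕 D S T α τ hτ t)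
      =ᵐ[Q] {ω | (t : ℝ≥0∞) < τ ω}.indicator Z := by
    refine indicator_condExp_enlarged 𝓕 hτ (hM.integrable_payoff hα.1 hτ ht) hZi
      hZm.aestronglyMeasurable fun A hA => ?_
    have hA' : MeasurableSet A := 𝓕.le t _ hA
    have e1 : ∫ ω in A, (1 - F t ω) * HY ω ∂Q
        = ∫ ω in A, ∫ u in Ioc t T, discount D t u ω * c u u ω ∂κ ω ∂Q :=
      setIntegral_congr_ae hA'
        ((h.survival_mul_hazardIntegral hF ht _).mono fun ω hω _ => hω)
    have e2 : ∫ ω in A, (1 - F t ω) * HX ω ∂Q = ∫ ω in A, (F T ω - F t ω) * ξ ω ∂Q := by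
      rw [h.setIntegral_asset hF ht hX hA]
      exact setIntegral_congr_ae hA'
        ((h.survival_mul_hazardIntegral hF ht _).mono fun ω hω _ => hω)
    -- Survival to `T` is survival to `t` minus the mass of `(t,T]`; by `e2` the latter is the asset
    -- hazard integral.
    have e3 : ∫ ω in A, (F T ω - F t ω) * ξ ω ∂Q
        = ∫ ω in A, (1 - F t ω) * ξ ω ∂Q - ∫ ω in A, (1 - F T ω) * ξ ω ∂Q := by
      rw [← integral_sub (h.integrable_survival_mul hF ht hξ).integrableOn
        (h.integrable_survival_mul hF le_rfl hξ).integrableOn]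
      refine integral_congr_ae (ae_of_all _ fun ω => ?_)
      simp only
      ring
    rw [h.setIntegral_payoff hF hM hα hτ ht (𝓕.mono ht _ hA),
      h.setIntegral_struck hF hM hα.1 hτ ht hY hA]
    rw [integral_sub hZ12.integrableOn hZ3.integrableOn,
      integral_add hZ1.integrableOn integrable_condExp.integrableOn, integral_const_mul,
      integral_const_mul, h.setIntegral_survival_condExp hF hτ ht hξ hA,
      h.setIntegral_survival_condExp hF hτ ht hYi hA,
      h.setIntegral_survival_condExp hF hτ ht hXi hA, e1, e2, e3]
    ring
  filter_upwards [hM.price_eq hα.1 hτ hτ_pos ht key, hM.condExp_discounted_asset ht] with ω h1 h2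
  rw [h1]
  by_cases hω : (t : ℝ≥0∞) < τ ω
  · simp only [indicator, mem_ofPred_eq, hω, if_true, Z, hξdef, h2]
    ring
  · simp [indicator, hω]

end Valuation

end

/-! ### Valuation under independence -/

noncomputable section

theorem _root_.MeasureTheory.Integrable.restrict_prod {Ω E : Type*} [MeasurableSpace Ω]
    [MeasurableSpace E] {Q : Measure Ω} [SFinite Q] {ν : Measure E} [SFinite ν] {f : Ω × E → ℝ}
    (hf : Integrable f (Q.prod ν)) (B : Set Ω) : Integrable f ((Q.restrict B).prod ν) := by
  have h : (Q.restrict B).prod ν = (Q.prod ν).restrict (B ×ˢ univ) := by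
    rw [← Measure.prod_restrict, Measure.restrict_univ]
  rw [h]
  exact hf.restrict

/-- An integral of `m`-measurable random variables is `m`-measurable, up to null sets. -/
theorem aestronglyMeasurable_integral_of_condExp {Ω E : Type*} {m m₀ : MeasurableSpace Ω}
    [MeasurableSpace E] {Q : Measure Ω} [IsFiniteMeasure Q] {ν : Measure E} [IsFiniteMeasure ν]
    (hm : m ≤ m₀) {g : E → Ω → ℝ} (hg : Integrable (fun p : Ω × E => g p.2 p.1) (Q.prod ν))
    (h : ∀ᵐ u ∂ν, Q[g u | m] =ᵐ[Q] g u) :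
    AEStronglyMeasurable[m] (fun ω => ∫ u, g u ω ∂ν) Q := by
  have hi : Integrable (fun ω => ∫ u, g u ω ∂ν) Q := hg.integral_prod_left
  refine ⟨Q[fun ω => ∫ u, g u ω ∂ν | m], stronglyMeasurable_condExp, ?_⟩
  -- Joint measurability of `g` is only known for the ambient σ-algebra, so the test sets `B` are
  -- arbitrary. Fubini and self-adjointness replace `1_B` by `V = E[1_B | m]`.
  refine hi.ae_eq_of_forall_setIntegral_eq _ _ integrable_condExp fun B hB _ => ?_
  rw [integral_condExp_mul_indicator hm hi hB]
  set V : Ω → ℝ := Q[B.indicator (1 : Ω → ℝ) | m] with hV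
  have hb : ∀ᵐ ω ∂Q, ‖V ω‖ ≤ 1 := norm_condExp_indicator_le_one hm hB
  have hVm : AEStronglyMeasurable V Q := integrable_condExp.aestronglyMeasurable
  have hgV : Integrable (fun p : Ω × E => g p.2 p.1 * V p.1) (Q.prod ν) :=
    hg.mul_bdd hVm.comp_fst (Measure.quasiMeasurePreserving_fst.ae hb)
  have hgB : Integrable (fun p : Ω × E => g p.2 p.1) ((Q.restrict B).prod ν) :=
    hg.restrict_prod B
  calc ∫ ω in B, ∫ u, g u ω ∂ν ∂Q = ∫ u, ∫ ω in B, g u ω ∂Q ∂ν := integral_integral_swap hgB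
    _ = ∫ u, ∫ ω, g u ω * V ω ∂Q ∂ν := by
        refine integral_congr_ae ?_
        filter_upwards [h, hg.prod_left_ae] with u hu hgu
        rw [← integral_condExp_mul_indicator hm hgu hB]
        exact setIntegral_congr_ae hB (hu.mono fun ω hω _ => hω.symm)
    _ = ∫ ω, ∫ u, g u ω * V ω ∂ν ∂Q := (integral_integral_swap hgV).symm
    _ = ∫ ω, (∫ u, g u ω ∂ν) * V ω ∂Q := by simp_rw [integral_mul_const]

variable {Ω : Type*} [m : MeasurableSpace Ω]

section Valuation

variable {Q : Measure Ω} [IsProbabilityMeasure Q] {𝓕 : Filtration ℝ≥0 m} {D S : ℝ≥0 → Ω → ℝ}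
  {T t : ℝ≥0} {α : ℝ} {τ : Ω → ℝ≥0∞} {F : ℝ≥0 → Ω → ℝ} {c : ℝ≥0 → ℝ≥0 → Ω → ℝ}

/-- For each `u` in `(t,T]`, `c t u` is almost surely nonnegative with mean at most that of `B(t,T)
S_T`, a bound uniform in `u`. -/
theorem IsForwardStartPrice.integrable_prod (hc : IsForwardStartPrice Q 𝓕 D S T α c)
    (hM : IsMarket Q 𝓕 D S T) (hα : 0 ≤ α) (ht : t ≤ T) (μ : Measure ℝ≥0) [IsFiniteMeasure μ] :
    Integrable (fun p : Ω × ℝ≥0 => c t p.2 p.1) (Q.prod (μ.restrict (Ioc t T))) := by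
  have hm : Measurable fun p : Ω × ℝ≥0 => c t p.2 p.1 := (hc.measurable t).comp measurable_swap
  refine (integrable_prod_iff' hm.aestronglyMeasurable).2 ⟨?_, ?_⟩
  · filter_upwards [ae_restrict_mem measurableSet_Ioc] with u hu
    exact integrable_condExp.congr (hc.version t u hu.1.le hu.2).symm
  · refine Integrable.of_bound
      (hm.stronglyMeasurable.norm.integral_prod_left').aestronglyMeasurable
      (∫ ω, discount D t T ω * S T ω ∂Q) ?_
    filter_upwards [ae_restrict_mem measurableSet_Ioc] with u hu
    have hi := hM.integrable_forwardPayoff (α := α) hα ht hu.2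
    have h0 : 0 ≤ᵐ[Q] Q[forwardPayoff D S T α t u | 𝓕 t] :=
      condExp_nonneg (ae_of_all _ fun ω => hM.forwardPayoff_nonneg t u ω)
    rw [Real.norm_of_nonneg (integral_nonneg fun _ => norm_nonneg _)]
    calc ∫ ω, ‖c t u ω‖ ∂Q = ∫ ω, (Q[forwardPayoff D S T α t u | 𝓕 t]) ω ∂Q := by
          refine integral_congr_ae ?_
          filter_upwards [h0, hc.version t u hu.1.le hu.2] with ω h1 h2
          have h3 : c t u ω = (Q[forwardPayoff D S T α t u | 𝓕 t]) ω := h2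
          rw [h3]
          exact Real.norm_of_nonneg h1
      _ = ∫ ω, forwardPayoff D S T α t u ω ∂Q := integral_condExp (𝓕.le t)
      _ ≤ _ := integral_mono hi (hM.integrable t T ht le_rfl)
          fun ω => hM.forwardPayoff_le hα t u ω

/-- This plays the role of the projection argument. Since `μ` does not depend on `ω`, Fubini fixes
`u`, and `A` in `𝓕 t` lets `c t u` be exchanged for the payoff. -/
theorem IsForwardStartPrice.setIntegral_integral (hc : IsForwardStartPrice Q 𝓕 D S T α c)
    (hM : IsMarket Q 𝓕 D S T) (hα : 0 ≤ α) (ht : t ≤ T) (μ : Measure ℝ≥0) [IsFiniteMeasure μ]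
    {A : Set Ω} (hA : MeasurableSet[𝓕 t] A) :
    ENNReal.ofReal (∫ ω in A, ∫ u in Ioc t T, c t u ω ∂μ ∂Q)
      = ∫⁻ ω, ∫⁻ u in Ioc t T, ENNReal.ofReal (forwardPayoff D S T α t u ω * A.indicator 1 ω)
          ∂μ ∂Q := by
  have hA' : MeasurableSet A := 𝓕.le t _ hA
  have hg := hc.integrable_prod hM hα ht μ
  have hgA : Integrable (fun p : Ω × ℝ≥0 => c t p.2 p.1)
      ((Q.restrict A).prod (μ.restrict (Ioc t T))) :=
    hg.restrict_prod A
  have hXm : Measurable fun p : Ω × ℝ≥0 => forwardPayoff D S T α t (min p.2 T) p.1 :=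
    measurable_uncurry_of_rightCts
      (fun _ hu => ((hM.stronglyMeasurable_forwardPayoff ht hu).mono (𝓕.le T)).measurable)
      (fun ω u _ => hM.forwardPayoff_rightCts t ω u)
  have hXAm : Measurable fun p : Ω × ℝ≥0 =>
      ENNReal.ofReal (forwardPayoff D S T α t (min p.2 T) p.1 * A.indicator 1 p.1) :=
    (hXm.mul ((measurable_one.indicator hA').comp measurable_fst)).ennreal_ofReal
  have hswap : ∫⁻ ω, ∫⁻ u in Ioc t T,
        ENNReal.ofReal (forwardPayoff D S T α t u ω * A.indicator 1 ω) ∂μ ∂Q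
      = ∫⁻ u in Ioc t T, ∫⁻ ω,
        ENNReal.ofReal (forwardPayoff D S T α t u ω * A.indicator 1 ω) ∂Q ∂μ := by
    calc _ = ∫⁻ ω, ∫⁻ u in Ioc t T, ENNReal.ofReal
          (forwardPayoff D S T α t (min u T) ω * A.indicator 1 ω) ∂μ ∂Q :=
          lintegral_congr fun ω => setLIntegral_congr_fun measurableSet_Ioc
            fun u hu => by simp only [min_eq_left hu.2]
      _ = ∫⁻ u in Ioc t T, ∫⁻ ω, ENNReal.ofReal
          (forwardPayoff D S T α t (min u T) ω * A.indicator 1 ω) ∂Q ∂μ :=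
          lintegral_lintegral_swap hXAm.aemeasurable
      _ = _ := setLIntegral_congr_fun measurableSet_Ioc
          fun u hu => by simp only [min_eq_left hu.2]
  have hval : ∀ᵐ u ∂μ.restrict (Ioc t T), 0 ≤ ∫ ω in A, c t u ω ∂Q ∧
      ENNReal.ofReal (∫ ω in A, c t u ω ∂Q)
      = ∫⁻ ω, ENNReal.ofReal (forwardPayoff D S T α t u ω * A.indicator 1 ω) ∂Q := by
    filter_upwards [ae_restrict_mem measurableSet_Ioc] with u hu
    have hi := hM.integrable_forwardPayoff (α := α) hα ht hu.2
    have h1 : ∫ ω in A, c t u ω ∂Q = ∫ ω in A, forwardPayoff D S T α t u ω ∂Q := by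
      rw [← setIntegral_condExp (𝓕.le t) hi hA]
      exact setIntegral_congr_ae hA' ((hc.version t u hu.1.le hu.2).mono fun ω hω _ => hω)
    rw [h1]
    refine ⟨integral_nonneg fun ω => hM.forwardPayoff_nonneg t u ω, ?_⟩
    rw [ofReal_integral_eq_lintegral_ofReal hi.integrableOn
      (ae_of_all _ fun ω => hM.forwardPayoff_nonneg t u ω), ← lintegral_indicator hA']
    refine lintegral_congr fun ω => ?_
    by_cases hω : ω ∈ A <;> simp [hω]
  rw [integral_integral_swap hgA, ofReal_integral_eq_lintegral_ofReal hgA.integral_prod_right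
    (hval.mono fun u hu => hu.1), hswap]
  exact lintegral_congr_ae (hval.mono fun u hu => hu.2)

theorem price_of_hypothesisIND (hM : IsMarket Q 𝓕 D S T)
    (hα : α ∈ Icc (0 : ℝ) 1) (hτ : Measurable τ) (hτ_pos : ∀ᵐ ω ∂Q, 0 < τ ω)
    (hc : IsForwardStartPrice Q 𝓕 D S T α c) (hF : IsCondDistribution Q 𝓕 τ T F) (ht : t ≤ T)
    (hI : HypothesisIND Q 𝓕 τ hτ) :
    HazardIntegrable Q F (c t) t T ∧
    price Q 𝓕 D S T α τ hτ t =ᵐ[Q] fun ω =>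
      struckTerm Q 𝓕 D S T α τ hτ t ω
      + {ω | (t : ℝ≥0∞) < τ ω}.indicator
          (fun ω => hazardIntegral F (c t) t T ω
            + (1 - α) * S t ω * Real.exp (-(hazard F T ω - hazard F t ω))) ω := by
  have h := hI.isHazardKernel hF
  set μ := Q.map (cappedTime τ T) with hμ
  have hP : IsProbabilityMeasure μ :=
    Measure.isProbabilityMeasure_map (measurable_cappedTime hτ T).aemeasurable
  have hg := hc.integrable_prod hM hα.1 ht μ
  have hSi := hM.asset_integrable ht
  have hξ := hM.integrable t T ht le_rfl
  set C : Ω → ℝ := fun ω => ∫ u in Ioc t T, c t u ω ∂μ with hCdef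
  have hCi : Integrable C Q := hg.integral_prod_left
  have hCm : AEStronglyMeasurable[𝓕 t] C Q := by
    refine aestronglyMeasurable_integral_of_condExp (𝓕.le t) hg ?_
    filter_upwards [ae_restrict_mem measurableSet_Ioc] with u hu
    have hv := hc.version t u hu.1.le hu.2
    refine (condExp_congr_ae hv).trans (EventuallyEq.trans ?_ hv.symm)
    rw [condExp_of_stronglyMeasurable (𝓕.le t) stronglyMeasurable_condExp integrable_condExp]
  have hdist : ∀ᵐ ω ∂Q, ∀ u ≤ T, F u ω = μ.real (Iic u) := h.distribution
  have hmem := h.ae_mem_Ico hF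
  -- `F_t` is almost surely a constant, so its value at one good `ω` gives the strict bound.
  have hp : μ.real (Iic t) < 1 := by
    obtain ⟨ω, h1, h2⟩ := (hdist.and hmem).exists
    rw [← h1 t ht]
    exact (h2 t ht).2
  have hp' : (1 - μ.real (Iic t)) ≠ 0 := by linarith
  -- Almost surely `a = e^{Γ_t}` and `b = e^{-Γ_T}`.
  set a := (1 - μ.real (Iic t))⁻¹ with ha
  set b := 1 - μ.real (Iic T) with hb
  refine ⟨h.hazardIntegrable hF ht hg.prod_right_ae, ?_⟩
  let Z : Ω → ℝ := fun ω => a * (C ω + (1 - α) * b * S t ω)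
  have hZi : Integrable Z Q := (hCi.add (hSi.const_mul _)).const_mul _
  have hZm : AEStronglyMeasurable[𝓕 t] Z Q :=
    (hCm.add ((hM.asset_adapted t).const_mul _).aestronglyMeasurable).const_mul _
  have key : {ω | (t : ℝ≥0∞) < τ ω}.indicator (price Q 𝓕 D S T α τ hτ t)
      =ᵐ[Q] {ω | (t : ℝ≥0∞) < τ ω}.indicator Z := by
    refine indicator_condExp_enlarged 𝓕 hτ (hM.integrable_payoff hα.1 hτ ht) hZi
      hZm fun A hA => ?_
    have hA' : MeasurableSet A := 𝓕.le t _ hA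
    have hAT := 𝓕.mono ht _ hA
    have hC0 : 0 ≤ ∫ ω in A, C ω ∂Q := by
      rw [integral_integral_swap (hg.restrict_prod A)]
      refine integral_nonneg_of_ae ?_
      filter_upwards [ae_restrict_mem measurableSet_Ioc] with u hu
      refine integral_nonneg_of_ae (ae_restrict_of_ae ?_)
      have h0 : 0 ≤ᵐ[Q] Q[forwardPayoff D S T α t u | 𝓕 t] :=
        condExp_nonneg (ae_of_all _ fun ω => hM.forwardPayoff_nonneg t u ω)
      exact h0.trans_eq (hc.version t u hu.1.le hu.2).symm
    have e1 : ∫ ω in A ∩ {ω | (t : ℝ≥0∞) < τ ω ∧ τ ω ≤ T},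
        forwardPayoff D S T α t (cappedTime τ T ω) ω ∂Q = ∫ ω in A, C ω ∂Q := by
      refine (ENNReal.ofReal_eq_ofReal_iff
        (integral_nonneg fun ω => hM.forwardPayoff_nonneg _ _ ω) hC0).1 ?_
      rw [hc.setIntegral_integral hM hα.1 ht μ hA, ofReal_integral_eq_lintegral_ofReal
        (hM.integrable_random_strike hα.1 ht (measurable_cappedTime hτ T)).integrableOn
        (ae_of_all _ fun ω => hM.forwardPayoff_nonneg _ _ ω),
        h.lintegral_sampled hτ ht (hM.measurable_uncurry_forwardPayoff ht) hAT]
      rfl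
    -- The survival probability to `T` is the constant `b`, so risk neutrality yields `S_t` with no
    -- hazard integral of the asset.
    have e2 : ∫ ω in A, (1 - F T ω) * (discount D t T ω * S T ω) ∂Q = b * ∫ ω in A, S t ω ∂Q := by
      rw [← setIntegral_congr_ae hA' ((hM.condExp_discounted_asset ht).mono fun ω hω _ => hω),
        setIntegral_condExp (𝓕.le t) hξ hA, ← integral_const_mul]
      refine setIntegral_congr_ae hA' (hdist.mono fun ω hω _ => ?_)
      rw [hω T le_rfl]
    have e3 : ∫ ω in A, (1 - F t ω) * Z ω ∂Q
        = ∫ ω in A, C ω ∂Q + (1 - α) * b * ∫ ω in A, S t ω ∂Q := by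
      rw [← integral_const_mul, ← integral_add hCi.integrableOn (hSi.const_mul _).integrableOn]
      refine setIntegral_congr_ae hA' (hdist.mono fun ω hω _ => ?_)
      rw [hω t ht]
      exact mul_inv_cancel_left₀ hp' _
    rw [h.setIntegral_payoff hF hM hα hτ ht hAT, e1, e2,
      h.setIntegral_survival hF hτ ht hZi (hZm.mono (𝓕.mono ht)) hAT, e3]
    ring
  filter_upwards [hM.price_eq hα.1 hτ hτ_pos ht key, h.ae_hazardIntegral hF ht, hdist,
    hF.lt_one] with ω h1 h2 h3 h4
  rw [h1]
  have h5 : Real.exp (-(hazard F T ω - hazard F t ω)) = a * b := by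
    have := exp_hazard_sub (f := fun u => F u ω) h4 ht le_rfl
    simp only [hazard]
    rw [this, h3 t ht, h3 T le_rfl]
  by_cases hω : (t : ℝ≥0∞) < τ ω
  · simp only [indicator, mem_ofPred_eq, hω, if_true, Z, h5, h2, h3 t ht, hCdef,
      Kernel.const_apply, ← ha]
    ring
  · simp [indicator, hω]

end Valuation

end

end RTFS

theorem mainTheorem1 {Ω : Type*} [m : MeasurableSpace Ω] (Q : Measure Ω) [IsProbabilityMeasure Q]
    (𝓕 : Filtration ℝ≥0 m) (D S : ℝ≥0 → Ω → ℝ) (T : ℝ≥0) (hM : RTFS.IsMarket Q 𝓕 D S T)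
    (α : ℝ) (hα : α ∈ Icc (0 : ℝ) 1)
    (τ : Ω → ℝ≥0∞) (hτ : Measurable τ) (hτ_pos : ∀ᵐ ω ∂Q, 0 < τ ω)
    (c : ℝ≥0 → ℝ≥0 → Ω → ℝ) (hc : RTFS.IsForwardStartPrice Q 𝓕 D S T α c)
    (F : ℝ≥0 → Ω → ℝ) (hF : RTFS.IsCondDistribution Q 𝓕 τ T F)
    (t : ℝ≥0) (ht : t ≤ T) :
    (Integrable (RTFS.payoff D S T α τ t) Q ∧ Integrable (RTFS.struckPayoff D S T α τ t) Q) ∧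
    (RTFS.HypothesisH Q 𝓕 τ hτ →
      RTFS.HazardIntegrable Q F (fun u ω => RTFS.discount D t u ω * c u u ω) t T ∧
      RTFS.HazardIntegrable Q F (fun u ω => RTFS.discount D t u ω * S u ω) t T ∧
      Integrable (RTFS.hazardIntegral F (fun u ω => RTFS.discount D t u ω * c u u ω) t T) Q ∧
      Integrable (RTFS.hazardIntegral F (fun u ω => RTFS.discount D t u ω * S u ω) t T) Q ∧
      RTFS.price Q 𝓕 D S T α τ hτ t =ᵐ[Q] fun ω =>
        RTFS.struckTerm Q 𝓕 D S T α τ hτ t ω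
        + (1 - α) * {ω | (t : ℝ≥0∞) < τ ω}.indicator (S t) ω
        + {ω | (t : ℝ≥0∞) < τ ω}.indicator
            (Q[RTFS.hazardIntegral F (fun u ω => RTFS.discount D t u ω * c u u ω) t T | 𝓕 t]) ω
        - (1 - α) * {ω | (t : ℝ≥0∞) < τ ω}.indicator
            (Q[RTFS.hazardIntegral F (fun u ω => RTFS.discount D t u ω * S u ω) t T | 𝓕 t]) ω) ∧
    (RTFS.HypothesisIND Q 𝓕 τ hτ →
      RTFS.HazardIntegrable Q F (c t) t T ∧
      RTFS.price Q 𝓕 D S T α τ hτ t =ᵐ[Q] fun ω =>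
        RTFS.struckTerm Q 𝓕 D S T α τ hτ t ω
        + {ω | (t : ℝ≥0∞) < τ ω}.indicator
            (fun ω => RTFS.hazardIntegral F (c t) t T ω
              + (1 - α) * S t ω * Real.exp (-(RTFS.hazard F T ω - RTFS.hazard F t ω))) ω) := by
  refine ⟨⟨hM.integrable_payoff hα.1 hτ ht, hM.integrable_struckPayoff hα.1 hτ ht⟩,
    fun hH => ?_, fun hI => ?_⟩
  · exact RTFS.price_of_hypothesisH hM hα hτ hτ_pos hc hF ht hH
  · exact RTFS.price_of_hypothesisIND hM hα hτ hτ_pos hc hF ht hI
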